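/- **Proposition.** Let $\mathcal C\subseteq\mathcal P^{\circ\bullet}$ be a case-$\mathcal O$ category of two-colored partitions and let $m\in\mathbb N=\{1,2,3,\ldots\}$. (a) If $L(\mathcal C)=m+2m\mathbb Z$ and $K(\mathcal C)=2m\mathbb Z$, then $X(\mathcal C)=\mathbb Z$ or $X(\mathcal C)=\mathbb Z\setminus m\mathbb Z$. (b) If $L(\mathcal C)=K(\mathcal C)=m\mathbb Z$, or if $L(\mathcal C)=\emptyset$ and $K(\mathcal C)=m\mathbb Z$, then $X(\mathcal C)=\mathbb Z$. Here the following definitions are used. A *two-colored partition* $p$ consists of a finite (possibly empty) row of upper points, a finite (possibly empty) row of lower points, a coloring of all points by $\circ$ and $\bullet$, and a decomposition of the set of all points into disjoint nonempty blocks; $\mathcal P^{\circ\bullet}$ is the set of all two-colored partitions. A *category of two-colored partitions* is a subset of $\mathcal P^{\circ\bullet}$ which is closed under horizontal concatenation (tensor product), under reflection at the horizontal axis (involution, which swaps the rows and keeps the colors) and under vertical concatenation (composition) of partitions whose rows to be glued have the same length and the same colors, the glued points being removed after joining blocks that are linked through them; and which contains both identity partitions (one upper and one lower point of the same color, forming a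 block) and both lower pair partitions (no upper points, two lower points colored $\circ\bullet$ respectively $\bullet\circ$, forming a block). A category is *case $\mathcal O$* if it contains neither the partition with no upper points and two lower points colored $\circ\bullet$, each a singleton block, nor the partition with no upper points and four lower points colored $\circ\bullet\circ\bullet$, all in one block. The *normalized color* of a lower point is its color, that of an upper point is the inverse of its color. The *color sum* $\sigma_p(S)$ of a set $S$ of points is the number of points in $S$ of normalized color $\circ$ minus the number of those of normalized color $\bullet$. The points of $p$ are cyclically ordered by running through the lower row from left to right and then through the upper row from right to left; $]\alpha,\beta[_p$ and $]\alpha,\beta]_p$ denote intervals with respect to this cyclic order. The *color distance* $\delta_p(\alpha,\beta)$ of points $\alpha\neq\beta$ is $\sigma_p(]\alpha,\beta]_p)$ if $\alpha$ and $\beta$ have the same normalized color, and $\sigma_p(]\alpha,\beta[_p)$ otherwise. Two distinct blocks $B_1$ and $B_2$ *cross* if there are $\beta_1,\gamma_1\in B_1$ and $\beta_2,\gamma_2\in B_2$ such that $(\beta_1,\beta_2,\gamma_1,\gamma_2)$ is in cyclic order. Finally, - $L(\mathcal C)$ is the set of all $\delta_p(\alpha_1,\alpha_2)$, where $p\in\mathcal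 C$, $B$ is a block of $p$, $\alpha_1,\alpha_2\in B$, $\alpha_1\ne\alpha_2$, $]\alpha_1,\alpha_2[_p\cap B=\emptyset$ and $\sigma_p(\{\alpha_1,\alpha_2\})\neq 0$; - $K(\mathcal C)$ is the set of all $\delta_p(\alpha_1,\alpha_2)$, where $p\in\mathcal C$, $B$ is a block of $p$, $\alpha_1,\alpha_2\in B$, $\alpha_1\ne\alpha_2$, $]\alpha_1,\alpha_2[_p\cap B=\emptyset$ and $\sigma_p(\{\alpha_1,\alpha_2\})= 0$; - $X(\mathcal C)$ is the set of all $\delta_p(\alpha_1,\alpha_2)$, where $p\in\mathcal C$, $B_1,B_2$ are crossing blocks of $p$, $\alpha_1\in B_1$ and $\alpha_2\in B_2$. -/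

import Mathlib

/-- The two (mutually inverse) colors: `white` is `∘` and `black` is `∙`. -/
inductive PointColor where
  | white : PointColor
  | black : PointColor

namespace PointColor

/-- The inverse color. -/
def flip : PointColor → PointColor
  | white => black
  | black => white

/-- The weight of a color in color sums: `∘` counts `+1` and `∙` counts `-1`. -/
def weight : PointColor → ℤ
  | white => 1
  | black => -1

end PointColor

/-- A two-colored partition with `k` upper and `l` lower points: a coloring of the points of either
row and a decomposition of the set of all points into disjoint blocks (given as an equivalence
relation). The points of both rows are numbered from left to right; `Sum.inl i` is the upper
point number `i` and `Sum.inr j` is the lower point number `j`. -/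
structure ColoredPartition (k l : ℕ) where
  /-- native colors of the upper points -/
  upper : Fin k → PointColor
  /-- native colors of the lower points -/
  lower : Fin l → PointColor
  /-- two points are related iff they belong to the same block -/
  rel : Setoid (Fin k ⊕ Fin l)

/-- The set `𝒫^{∘∙}` of all two-colored partitions, with any numbers of upper and lower points. -/
abbrev AnyColoredPartition : Type := Σ k l : ℕ, ColoredPartition k l

namespace ColoredPartition

/-! ### Category operations -/

/-- The involution: reflection at the horizontal axis. -/
def adjoint {k l : ℕ} (p : ColoredPartition k l) : ColoredPartition l k where
  upper := p.lower
  lower := p.upper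
  rel := Setoid.comap Sum.swap p.rel

/-- Two points of the tensor product, each sorted into the left or the right factor, belong to the
same block iff they come from the same factor and belong to the same block there. -/
def sumSetoid {α β : Type} (r : Setoid α) (s : Setoid β) : Setoid (α ⊕ β) where
  r := Sum.LiftRel r s
  iseqv :=
    { refl := by
        rintro (a | b)
        · exact Sum.LiftRel.inl (r.refl a)
        · exact Sum.LiftRel.inr (s.refl b)
      symm := by
        rintro _ _ (h | h)
        · exact Sum.LiftRel.inl (r.symm h)
        · exact Sum.LiftRel.inr (s.symm h)
      trans := by
        rintro _ _ _ (h | h) (h' | h')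
        · exact Sum.LiftRel.inl (r.trans h h')
        · exact Sum.LiftRel.inr (s.trans h h') }

/-- Sorts the points of a horizontal concatenation into those of the left and of the right part. -/
def splitPoints (k l k' l' : ℕ) :
    Fin (k + k') ⊕ Fin (l + l') ≃ (Fin k ⊕ Fin l) ⊕ (Fin k' ⊕ Fin l') :=
  (Equiv.sumCongr finSumFinEquiv.symm finSumFinEquiv.symm).trans
    (Equiv.sumSumSumComm (Fin k) (Fin k') (Fin l) (Fin l'))

/-- The tensor product `p ⊗ q`: horizontal concatenation, `p` on the left and `q` on the right. -/
def tensor {k l k' l' : ℕ} (p : ColoredPartition k l) (q : ColoredPartition k' l') :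
    ColoredPartition (k + k') (l + l') where
  upper := Fin.append p.upper q.upper
  lower := Fin.append p.lower q.lower
  rel := Setoid.comap (splitPoints k l k' l') (sumSetoid p.rel q.rel)

/-- When `p` is put on top of `q`, with the lower row of `p` glued to the upper row of `q`, there
are three rows: upper (`Sum.inl`), middle (`Sum.inr ∘ Sum.inl`), lower (`Sum.inr ∘ Sum.inr`).
Two points are directly linked if they belong to the same block of `p` or of `q`. -/
inductive Linked {k l n : ℕ} (p : ColoredPartition k l) (q : ColoredPartition l n) :
    Fin k ⊕ (Fin l ⊕ Fin n) → Fin k ⊕ (Fin l ⊕ Fin n) → Prop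
  | top {x y : Fin k ⊕ Fin l} (h : p.rel x y) :
      Linked p q (Sum.map id Sum.inl x) (Sum.map id Sum.inl y)
  | bottom {x y : Fin l ⊕ Fin n} (h : q.rel x y) :
      Linked p q (Sum.inr x) (Sum.inr y)

/-- The composition of `p` and `q`: vertical concatenation, `p` on top of `q`. Points belong to the
same block iff they are connected via the three rows; the middle row is then removed. -/
def comp {k l n : ℕ} (p : ColoredPartition k l) (q : ColoredPartition l n) :
    ColoredPartition k n where
  upper := p.upper
  lower := q.lower
  rel := Setoid.comap (Sum.map id Sum.inr) (Relation.EqvGen.setoid (Linked p q))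

/-! ### Particular partitions -/

/-- The identity partition of color `c`: one upper and one lower point, both of color `c`,
forming a block. -/
def identity (c : PointColor) : ColoredPartition 1 1 where
  upper := fun _ => c
  lower := fun _ => c
  rel := ⊤

/-- The pair block on two lower points with colors `c` and the inverse of `c`. -/
def lowerPair (c : PointColor) : ColoredPartition 0 2 where
  upper := Fin.elim0
  lower := ![c, c.flip]
  rel := ⊤

/-- Two lower points of colors `∘∙`, each a singleton block. -/
def lowerSingletons : ColoredPartition 0 2 where
  upper := Fin.elim0
  lower := ![PointColor.white, PointColor.black]
  rel := ⊥

/-- Four lower points of colors `∘∙∘∙`, forming one single block. -/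
def lowerFourBlock : ColoredPartition 0 4 where
  upper := Fin.elim0
  lower := ![PointColor.white, PointColor.black, PointColor.white, PointColor.black]
  rel := ⊤

/-! ### Cyclic order, color sums and color distances -/

/-- The position of a point when all points are listed counter-clockwise: first the lower row from
left to right, then the upper row from right to left. -/
def position {k l : ℕ} : Fin k ⊕ Fin l → ℕ
  | Sum.inr j => j
  | Sum.inl i => l + (k - 1 - i)

/-- `(α, β, γ)` is ordered with respect to the cyclic order of the points
(which forces the three points to be distinct). -/
def Ordered {k l : ℕ} (α β γ : Fin k ⊕ Fin l) : Prop :=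
  (position α < position β ∧ position β < position γ) ∨
  (position β < position γ ∧ position γ < position α) ∨
  (position γ < position α ∧ position α < position β)

/-- The open interval `]α, β[` (for distinct `α` and `β`) with respect to the cyclic order. -/
def openInterval {k l : ℕ} (α β : Fin k ⊕ Fin l) : Set (Fin k ⊕ Fin l) :=
  {γ | Ordered α γ β}

/-- The normalized color of a point: the native color on the lower row, the inverse of the native
color on the upper row. -/
def normalizedColor {k l : ℕ} (p : ColoredPartition k l) : Fin k ⊕ Fin l → PointColor
  | Sum.inl i => (p.upper i).flip
  | Sum.inr j => p.lower j

/-- The color sum `σ_p(S)`: the number of points in `S` of normalized color `∘` minus the number of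
points in `S` of normalized color `∙`. -/
noncomputable def colorSum {k l : ℕ} (p : ColoredPartition k l) (S : Set (Fin k ⊕ Fin l)) : ℤ :=
  ∑ x, S.indicator (fun y => (p.normalizedColor y).weight) x

open Classical in
/-- The color distance `δ_p(α, β)` of two distinct points: `σ_p(]α, β])` if `α` and `β` have the
same normalized color, and `σ_p(]α, β[)` otherwise. -/
noncomputable def colorDist {k l : ℕ} (p : ColoredPartition k l) (α β : Fin k ⊕ Fin l) : ℤ :=
  if p.normalizedColor α = p.normalizedColor β then p.colorSum (insert β (openInterval α β))
  else p.colorSum (openInterval α β)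

/-- The set of blocks. -/
def blocks {k l : ℕ} (p : ColoredPartition k l) : Set (Set (Fin k ⊕ Fin l)) :=
  p.rel.classes

/-- Two distinct blocks cross if `(β₁, β₂, γ₁, γ₂)` is cyclically ordered for some legs
`β₁, γ₁` of the first and `β₂, γ₂` of the second. -/
def Crosses {k l : ℕ} (B₁ B₂ : Set (Fin k ⊕ Fin l)) : Prop :=
  B₁ ≠ B₂ ∧ ∃ β₁ ∈ B₁, ∃ γ₁ ∈ B₁, ∃ β₂ ∈ B₂, ∃ γ₂ ∈ B₂,
    Ordered β₁ β₂ γ₁ ∧ Ordered γ₁ γ₂ β₁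

/-! ### Categories -/

/-- A category of two-colored partitions: a set of two-colored partitions that contains the
identity partitions and the lower pair partitions of either coloring and is closed under tensor
products, involution, and composition of composable partitions. -/
structure IsCategory (C : Set AnyColoredPartition) : Prop where
  identity_mem : ∀ c : PointColor, ⟨1, 1, identity c⟩ ∈ C
  lowerPair_mem : ∀ c : PointColor, ⟨0, 2, lowerPair c⟩ ∈ C
  tensor_mem : ∀ {k l k' l' : ℕ} (p : ColoredPartition k l) (q : ColoredPartition k' l'),
    ⟨k, l, p⟩ ∈ C → ⟨k', l', q⟩ ∈ C → ⟨k + k', l + l', p.tensor q⟩ ∈ C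
  adjoint_mem : ∀ {k l : ℕ} (p : ColoredPartition k l), ⟨k, l, p⟩ ∈ C → ⟨l, k, p.adjoint⟩ ∈ C
  comp_mem : ∀ {k l n : ℕ} (p : ColoredPartition k l) (q : ColoredPartition l n),
    p.lower = q.upper → ⟨k, l, p⟩ ∈ C → ⟨l, n, q⟩ ∈ C → ⟨k, n, p.comp q⟩ ∈ C

/-- A case `𝒪` category: a category containing neither the partition with two lower singletons
colored `∘∙` nor the partition with one block of four lower points colored `∘∙∘∙`. -/
structure IsCaseO (C : Set AnyColoredPartition) : Prop extends IsCategory C where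
  lowerSingletons_notMem : ⟨0, 2, lowerSingletons⟩ ∉ C
  lowerFourBlock_notMem : ⟨0, 4, lowerFourBlock⟩ ∉ C

/-! ### The parameters `L`, `K` and `X` -/

/-- `L(S)`: the color distances between subsequent legs of the same block having the same
normalized color. -/
def paramL (S : Set AnyColoredPartition) : Set ℤ :=
  {d | ∃ (k l : ℕ) (p : ColoredPartition k l), ⟨k, l, p⟩ ∈ S ∧ ∃ B ∈ p.blocks,
    ∃ α₁ ∈ B, ∃ α₂ ∈ B, α₁ ≠ α₂ ∧ openInterval α₁ α₂ ∩ B = ∅ ∧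
      p.colorSum {α₁, α₂} ≠ 0 ∧ d = p.colorDist α₁ α₂}

/-- `K(S)`: the color distances between subsequent legs of the same block having different
normalized colors. -/
def paramK (S : Set AnyColoredPartition) : Set ℤ :=
  {d | ∃ (k l : ℕ) (p : ColoredPartition k l), ⟨k, l, p⟩ ∈ S ∧ ∃ B ∈ p.blocks,
    ∃ α₁ ∈ B, ∃ α₂ ∈ B, α₁ ≠ α₂ ∧ openInterval α₁ α₂ ∩ B = ∅ ∧
      p.colorSum {α₁, α₂} = 0 ∧ d = p.colorDist α₁ α₂}

/-- `X(S)`: the color distances between any two legs belonging to two crossing blocks. -/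
def paramX (S : Set AnyColoredPartition) : Set ℤ :=
  {d | ∃ (k l : ℕ) (p : ColoredPartition k l), ⟨k, l, p⟩ ∈ S ∧
    ∃ B₁ ∈ p.blocks, ∃ B₂ ∈ p.blocks, Crosses B₁ B₂ ∧
      ∃ α₁ ∈ B₁, ∃ α₂ ∈ B₂, d = p.colorDist α₁ α₂}

end ColoredPartition

/-! Up to rotation, a partition of the category is a cyclic word of colored letters, each labelled
by its block. In case 𝒪 every block has exactly two legs (`Mem.count_eq_two`): gluing a partition to
its reflection would turn a singleton block into the two forbidden singletons, and a block with
three or more legs into the forbidden four-block.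

The set X is a union of residue classes modulo `m`. Gluing one of two legs at distance `e` of some
block onto a leg of a crossing block moves that leg by `e` (`add_mem_paramX`), and L ∪ K is the set
of all multiples of `m` in each of the cases considered.

It remains to realize the class of a given `d` (`exists_mem_paramX`). Take two legs of a block at
distance `m` and give each letter in between its distance from the first leg, its height. If X
misses the class of `d`, then a block with a letter of height ≡ `d` in between does not cross the
chosen block, so both of its legs lie in between. Their heights are congruent, as L and K consist of
multiples of `m`. Hence the number of these letters is even. But a lattice path from 0 to `m`
traverses each residue class an odd number of times (`even_countP_heights`), a contradiction.

If the two legs have the same color, the path reaches `m` only with the step of the second leg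
itself. That step belongs to the class of 0, about which nothing follows then. This is the source of
the alternative in (a), where `m` lies in L. In (b), `m` lies in K, and all classes are realized. -/

namespace ColoredPartition

/-- A category `C` contains a partition whose upper and lower row, read from left to right, have
the colors given by `U` and `V`, and whose blocks are the classes of points with equal labels. -/
def Mem (C : Set AnyColoredPartition) {β : Type} (U V : List (PointColor × β)) : Prop :=
  ∃ (k l : ℕ) (p : ColoredPartition k l) (f : Fin k ⊕ Fin l → β),
    (⟨k, l, p⟩ : AnyColoredPartition) ∈ C ∧ (∀ x y, p.rel x y ↔ f x = f y) ∧
    U = List.ofFn (fun i => (p.upper i, f (Sum.inl i))) ∧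
    V = List.ofFn (fun j => (p.lower j, f (Sum.inr j)))

/-- Applying a function to all labels of a word. -/
def relabel {β γ : Type} (F : β → γ) (w : List (PointColor × β)) : List (PointColor × γ) :=
  w.map (Prod.map id F)

/-! ### Relabelling of words -/

section relabel
variable {β γ δ : Type}

@[simp] theorem relabel_nil (F : β → γ) : relabel F [] = [] := rfl

@[simp] theorem relabel_cons (F : β → γ) (a : PointColor × β) (w) :
    relabel F (a :: w) = (a.1, F a.2) :: relabel F w := rfl

@[simp] theorem relabel_append (F : β → γ) (v w : List (PointColor × β)) :
    relabel F (v ++ w) = relabel F v ++ relabel F w := List.map_append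

@[simp] theorem relabel_relabel (F : β → γ) (G : γ → δ) (w : List (PointColor × β)) :
    relabel G (relabel F w) = relabel (fun x => G (F x)) w := by
  simp [relabel, Function.comp_def]

@[simp] theorem relabel_id (w : List (PointColor × β)) : relabel (fun x => x) w = w :=
  List.map_id w

@[simp] theorem map_fst_relabel (F : β → γ) (w : List (PointColor × β)) :
    (relabel F w).map Prod.fst = w.map Prod.fst := by
  simp [relabel]

@[simp] theorem map_snd_relabel (F : β → γ) (w : List (PointColor × β)) :
    (relabel F w).map Prod.snd = (w.map Prod.snd).map F := by
  simp [relabel]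

theorem relabel_eq_of_map_eq {F : β → δ} {G : γ → δ} {v : List (PointColor × β)}
    {w : List (PointColor × γ)} (h₁ : v.map Prod.fst = w.map Prod.fst)
    (h₂ : (v.map Prod.snd).map F = (w.map Prod.snd).map G) : relabel F v = relabel G w := by
  induction v generalizing w with
  | nil => cases w <;> simp_all
  | cons a v ih =>
    cases w with
    | nil => simp at h₁
    | cons b w =>
      simp only [List.map_cons, List.cons.injEq] at h₁ h₂
      simp [h₁.1, h₂.1, ih h₁.2 h₂.2]

end relabel

/-! ### Category operations in terms of labelled words -/

variable {C : Set AnyColoredPartition} {β γ : Type}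

/-- The two labelled rows determine colors and blocks, hence the partition. This transports
membership to the explicit partitions excluded in case 𝒪. -/
theorem Mem.sigma_mem {U V : List (PointColor × β)} (h : Mem C U V) {k l : ℕ}
    (p : ColoredPartition k l) (f : Fin k ⊕ Fin l → β) (hf : ∀ x y, p.rel x y ↔ f x = f y)
    (hU : U = List.ofFn (fun i => (p.upper i, f (Sum.inl i))))
    (hV : V = List.ofFn (fun j => (p.lower j, f (Sum.inr j)))) :
    (⟨k, l, p⟩ : AnyColoredPartition) ∈ C := by
  obtain ⟨k', l', q, g, hq, hg, hU', hV'⟩ := h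
  obtain rfl : k = k' := by simpa using congrArg List.length (hU.symm.trans hU')
  obtain rfl : l = l' := by simpa using congrArg List.length (hV.symm.trans hV')
  have h₁ := List.ofFn_injective (hU.symm.trans hU')
  have h₂ := List.ofFn_injective (hV.symm.trans hV')
  have hfg : f = g := by
    funext x
    rcases x with i | j
    · exact congrArg Prod.snd (congrFun h₁ i)
    · exact congrArg Prod.snd (congrFun h₂ j)
  have : p = q := by
    obtain ⟨pu, pl, pr⟩ := p
    obtain ⟨qu, ql, qr⟩ := q
    congr 1
    · funext i; exact congrArg Prod.fst (congrFun h₁ i)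
    · funext i; exact congrArg Prod.fst (congrFun h₂ i)
    · ext x y
      exact (hf x y).trans (by rw [hfg]; exact (hg x y).symm)
  rwa [this]

theorem Mem.relabel {U V : List (PointColor × β)} (h : Mem C U V) (F : β → γ)
    (hF : ∀ x ∈ (U ++ V).map Prod.snd, ∀ y ∈ (U ++ V).map Prod.snd, F x = F y → x = y) :
    Mem C (relabel F U) (relabel F V) := by
  obtain ⟨k, l, p, f, hp, hf, hU, hV⟩ := h
  refine ⟨k, l, p, F ∘ f, hp, fun x y => (hf x y).trans ⟨congrArg F, hF _ ?_ _ ?_⟩, ?_, ?_⟩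
  · rcases x with i | i <;> simp [hU, hV, List.mem_ofFn]
  · rcases y with i | i <;> simp [hU, hV, List.mem_ofFn]
  · simp [hU, ColoredPartition.relabel, List.map_ofFn, Function.comp_def]
  · simp [hV, ColoredPartition.relabel, List.map_ofFn, Function.comp_def]

theorem Mem.adjoint (hC : IsCategory C) {U V : List (PointColor × β)} (h : Mem C U V) :
    Mem C V U := by
  obtain ⟨k, l, p, f, hp, hf, hU, hV⟩ := h
  exact ⟨l, k, p.adjoint, f ∘ Sum.swap, hC.adjoint_mem p hp, fun x y => hf _ _, hV, hU⟩

theorem ofFn_append_eq {α : Type} {k l : ℕ} (f : Fin (k + l) → α) :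
    List.ofFn f = List.ofFn (fun i => f (Fin.castAdd l i)) ++
      List.ofFn (fun i => f (Fin.natAdd k i)) := by
  rw [← List.ofFn_fin_append, Fin.append_castAdd_natAdd]

theorem Mem.tensor (hC : IsCategory C) {U V : List (PointColor × β)}
    {U' V' : List (PointColor × γ)} (h : Mem C U V) (h' : Mem C U' V') :
    Mem C (ColoredPartition.relabel Sum.inl U ++ ColoredPartition.relabel Sum.inr U')
      (ColoredPartition.relabel Sum.inl V ++ ColoredPartition.relabel Sum.inr V') := by
  obtain ⟨k, l, p, f, hp, hf, rfl, rfl⟩ := h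
  obtain ⟨k', l', p', f', hp', hf', rfl, rfl⟩ := h'
  refine ⟨_, _, p.tensor p', Sum.map f f' ∘ splitPoints k l k' l', hC.tensor_mem p p' hp hp',
    fun x y => ?_, ?_, ?_⟩
  · change Sum.LiftRel p.rel p'.rel _ _ ↔ _
    simp only [Function.comp_apply]
    rcases splitPoints k l k' l' x with a | a <;> rcases splitPoints k l k' l' y with b | b
    · simpa using hf a b
    · simp
    · simp
    · simpa using hf' a b
  · rw [ofFn_append_eq]
    simp [ColoredPartition.relabel, List.map_ofFn, Function.comp_def, ColoredPartition.tensor,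
      splitPoints]
  · rw [ofFn_append_eq]
    simp [ColoredPartition.relabel, List.map_ofFn, Function.comp_def, ColoredPartition.tensor,
      splitPoints]

/-- The relation that identifies the labels of the middle row of a composition. -/
def MidRel {k l n : ℕ} (f : Fin k ⊕ Fin l → β) (g : Fin l ⊕ Fin n → γ) (z w : β ⊕ γ) : Prop :=
  ∃ i, z = Sum.inl (f (Sum.inr i)) ∧ w = Sum.inr (g (Sum.inl i))

/-- A point of the three rows of a composition carries a label. -/
def HasLabel {k l n : ℕ} (f : Fin k ⊕ Fin l → β) (g : Fin l ⊕ Fin n → γ)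
    (P : Fin k ⊕ (Fin l ⊕ Fin n)) (z : β ⊕ γ) : Prop :=
  (∃ x, P = Sum.map id Sum.inl x ∧ z = Sum.inl (f x)) ∨ (∃ y, P = Sum.inr y ∧ z = Sum.inr (g y))

/-- Instead of linking points, one may identify the two labels that each middle point carries:
points with a common label are linked, and links only ever join points whose labels become
identified. -/
theorem comp_rel_iff {k l n : ℕ} (p : ColoredPartition k l) (q : ColoredPartition l n)
    (f : Fin k ⊕ Fin l → β) (g : Fin l ⊕ Fin n → γ) (hf : ∀ x y, p.rel x y ↔ f x = f y)
    (hg : ∀ x y, q.rel x y ↔ g x = g y) (x y : Fin k ⊕ Fin n) :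
    (p.comp q).rel x y ↔
      Sum.elim (fun i => Quot.mk (MidRel f g) (Sum.inl (f (Sum.inl i))))
        (fun j => Quot.mk (MidRel f g) (Sum.inr (g (Sum.inr j)))) x =
      Sum.elim (fun i => Quot.mk (MidRel f g) (Sum.inl (f (Sum.inl i))))
        (fun j => Quot.mk (MidRel f g) (Sum.inr (g (Sum.inr j)))) y := by
  have key : ∀ x : Fin k ⊕ Fin n, ∃ z, HasLabel f g (Sum.map id Sum.inr x) z ∧
      Sum.elim (fun i => Quot.mk (MidRel f g) (Sum.inl (f (Sum.inl i))))
        (fun j => Quot.mk (MidRel f g) (Sum.inr (g (Sum.inr j)))) x = Quot.mk _ z := by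
    rintro (i | j)
    · exact ⟨_, Or.inl ⟨Sum.inl i, rfl, rfl⟩, rfl⟩
    · exact ⟨_, Or.inr ⟨Sum.inr j, rfl, rfl⟩, rfl⟩
  have total : ∀ P : Fin k ⊕ (Fin l ⊕ Fin n), ∃ z, HasLabel f g P z := by
    rintro (i | j | j)
    · exact ⟨_, Or.inl ⟨Sum.inl i, rfl, rfl⟩⟩
    · exact ⟨_, Or.inl ⟨Sum.inr j, rfl, rfl⟩⟩
    · exact ⟨_, Or.inr ⟨Sum.inr j, rfl, rfl⟩⟩
  have uniq : ∀ P z w, HasLabel f g P z → HasLabel f g P w →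
      Quot.mk (MidRel f g) z = Quot.mk _ w := by
    rintro P z w (⟨x, rfl, rfl⟩ | ⟨x, rfl, rfl⟩) (⟨y, h, rfl⟩ | ⟨y, h, rfl⟩)
    · rcases x with x | x <;> rcases y with y | y <;> simp_all
    · rcases x with x | x
      · simp at h
      · obtain rfl : Sum.inl x = y := by simpa using h
        exact Quot.sound ⟨x, rfl, rfl⟩
    · rcases y with y | y
      · simp at h
      · obtain rfl : x = Sum.inl y := by simpa using h
        exact (Quot.sound ⟨y, rfl, rfl⟩).symm
    · obtain rfl : x = y := by simpa using h
      rfl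
  have link : ∀ P Q z, HasLabel f g P z → HasLabel f g Q z →
      Relation.EqvGen (Linked p q) P Q := by
    rintro P Q z (⟨x, rfl, rfl⟩ | ⟨x, rfl, rfl⟩) (⟨y, rfl, h⟩ | ⟨y, rfl, h⟩)
    · exact .rel _ _ (.top ((hf _ _).2 (by simpa using h)))
    · simp at h
    · simp at h
    · exact .rel _ _ (.bottom ((hg _ _).2 (by simpa using h)))
  obtain ⟨z, hz, hz'⟩ := key x
  obtain ⟨w, hw, hw'⟩ := key y
  rw [hz', hw']
  change Relation.EqvGen (Linked p q) _ _ ↔ _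
  constructor
  · have : ∀ P Q, Relation.EqvGen (Linked p q) P Q → ∀ z w, HasLabel f g P z →
        HasLabel f g Q w → Quot.mk (MidRel f g) z = Quot.mk _ w := by
      intro P Q h
      induction h with
      | rel P Q h =>
        intro z w hz hw
        cases h with
        | top h =>
          rw [uniq _ _ _ hz (Or.inl ⟨_, rfl, rfl⟩), uniq _ _ _ hw (Or.inl ⟨_, rfl, rfl⟩),
            (hf _ _).1 h]
        | bottom h =>
          rw [uniq _ _ _ hz (Or.inr ⟨_, rfl, rfl⟩), uniq _ _ _ hw (Or.inr ⟨_, rfl, rfl⟩),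
            (hg _ _).1 h]
      | refl P => exact uniq P
      | symm P Q _ ih => exact fun z w hz hw => (ih w z hw hz).symm
      | trans P Q S _ _ ih₁ ih₂ =>
        intro z w hz hw
        obtain ⟨y, hy⟩ := total Q
        exact (ih₁ z y hz hy).trans (ih₂ y w hy hw)
    exact fun h => this _ _ h z w hz hw
  · intro h
    -- Being linked to all points with a given label is invariant under `MidRel`, since the middle
    -- point behind each identification carries both labels.
    have inv : ∀ z w, Relation.EqvGen (MidRel f g) z w → ∀ P,
        ((∀ Q, HasLabel f g Q z → Relation.EqvGen (Linked p q) P Q) ↔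
          (∀ Q, HasLabel f g Q w → Relation.EqvGen (Linked p q) P Q)) := by
      intro z w h
      induction h with
      | rel z w h =>
        obtain ⟨i, rfl, rfl⟩ := h
        have h₁ : HasLabel f g (Sum.inr (Sum.inl i)) (Sum.inl (f (Sum.inr i))) :=
          Or.inl ⟨Sum.inr i, rfl, rfl⟩
        have h₂ : HasLabel f g (Sum.inr (Sum.inl i)) (Sum.inr (g (Sum.inl i))) :=
          Or.inr ⟨Sum.inl i, rfl, rfl⟩
        exact fun P => ⟨fun h Q hQ => (h _ h₁).trans _ _ _ (link _ _ _ h₂ hQ),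
          fun h Q hQ => (h _ h₂).trans _ _ _ (link _ _ _ h₁ hQ)⟩
      | refl => exact fun _ => Iff.rfl
      | symm _ _ _ ih => exact fun P => (ih P).symm
      | trans _ _ _ _ _ ih₁ ih₂ => exact fun P => (ih₁ P).trans (ih₂ P)
    exact (inv z w (Quot.eqvGen_exact h) _).1 (fun Q hQ => link _ _ _ hz hQ) _ hw

/-- The labels of a composition form the pushout of the two label sets along the middle row. The
universal property serves to prove labels distinct: it suffices to find compatible labellings of the
two factors that separate them. -/
theorem Mem.comp (hC : IsCategory C) {U V : List (PointColor × β)}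
    {V' W : List (PointColor × γ)} (h : Mem C U V) (h' : Mem C V' W)
    (hV : V.map Prod.fst = V'.map Prod.fst) :
    ∃ (δ : Type) (F : β → δ) (G : γ → δ),
      Mem C (ColoredPartition.relabel F U) (ColoredPartition.relabel G W) ∧
      (V.map Prod.snd).map F = (V'.map Prod.snd).map G ∧
      ∀ (ε : Type) (F' : β → ε) (G' : γ → ε),
        (V.map Prod.snd).map F' = (V'.map Prod.snd).map G' →
          ∃ φ : δ → ε, (∀ x, φ (F x) = F' x) ∧ ∀ x, φ (G x) = G' x := by
  obtain ⟨k, l, p, f, hp, hf, rfl, rfl⟩ := h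
  obtain ⟨l', n, q, g, hq, hg, rfl, rfl⟩ := h'
  obtain rfl : l = l' := by simpa using congrArg List.length hV
  have hpq : p.lower = q.upper := by
    simp only [List.map_ofFn] at hV
    exact List.ofFn_injective hV
  refine ⟨Quot (MidRel f g), fun x => Quot.mk _ (Sum.inl x), fun x => Quot.mk _ (Sum.inr x),
    ⟨k, n, p.comp q, _, hC.comp_mem p q hpq hp hq, comp_rel_iff p q f g hf hg, ?_, ?_⟩, ?_, ?_⟩
  · simp [ColoredPartition.relabel, List.map_ofFn, Function.comp_def, ColoredPartition.comp]
  · simp [ColoredPartition.relabel, List.map_ofFn, Function.comp_def, ColoredPartition.comp]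
  · simp only [List.map_ofFn]
    congr 1
    funext i
    exact Quot.sound ⟨i, rfl, rfl⟩
  · intro ε F' G' h
    simp only [List.map_ofFn] at h
    have h := List.ofFn_injective h
    refine ⟨Quot.lift (Sum.elim F' G') ?_, fun x => rfl, fun x => rfl⟩
    rintro _ _ ⟨i, rfl, rfl⟩
    exact congrFun h i

/-- Closing a pair with its own reflection leaves no points. -/
theorem Mem.nil (hC : IsCategory C) : Mem C ([] : List (PointColor × β)) [] := by
  obtain ⟨k, l, p, hp⟩ : ∃ k l, ∃ p : ColoredPartition k l, (⟨k, l, p⟩ : AnyColoredPartition) ∈ C ∧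
      k = 0 ∧ l = 0 :=
    ⟨0, 0, _, hC.comp_mem _ _ rfl (hC.lowerPair_mem .white)
      (hC.adjoint_mem _ (hC.lowerPair_mem .white)), rfl, rfl⟩
  obtain ⟨hp, rfl, rfl⟩ := hp
  exact ⟨0, 0, p, fun x => (isEmptyElim x), hp, fun x => isEmptyElim x, by simp, by simp⟩

theorem Mem.pair (hC : IsCategory C) (c : PointColor) (x : β) :
    Mem C [] [(c, x), (c.flip, x)] :=
  ⟨0, 2, lowerPair c, fun _ => x, hC.lowerPair_mem c,
    fun _ _ => ⟨fun _ => rfl, fun _ => trivial⟩, by simp, by simp [lowerPair]⟩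

theorem Mem.disjoint_append (hC : IsCategory C) {U V U' V' : List (PointColor × β)}
    (h : Mem C U V) (h' : Mem C U' V')
    (hd : ∀ x ∈ (U ++ V).map Prod.snd, x ∉ (U' ++ V').map Prod.snd) :
    Mem C (U ++ U') (V ++ V') := by
  have := (h.tensor hC h').relabel (Sum.elim id id) ?_
  · simpa using this
  · intro x hx y hy hxy
    have hx : (∃ z, x = Sum.inl z ∧ z ∈ (U ++ V).map Prod.snd) ∨
        (∃ z, x = Sum.inr z ∧ z ∈ (U' ++ V').map Prod.snd) := by
      simp only [map_snd_relabel, List.map_append, List.mem_append, List.mem_map] at hx ⊢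
      grind
    have hy : (∃ z, y = Sum.inl z ∧ z ∈ (U ++ V).map Prod.snd) ∨
        (∃ z, y = Sum.inr z ∧ z ∈ (U' ++ V').map Prod.snd) := by
      simp only [map_snd_relabel, List.map_append, List.mem_append, List.mem_map] at hy ⊢
      grind
    obtain ⟨z, rfl, hz⟩ | ⟨z, rfl, hz⟩ := hx <;> obtain ⟨w, rfl, hw⟩ | ⟨w, rfl, hw⟩ := hy <;>
      simp at hxy <;> grind

theorem Mem.identities (hC : IsCategory C) {U : List (PointColor × β)}
    (hU : (U.map Prod.snd).Nodup) : Mem C U U := by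
  induction U with
  | nil => exact Mem.nil hC
  | cons a U ih =>
    simp only [List.map_cons, List.nodup_cons] at hU
    have h₁ : Mem C [a] [a] :=
      ⟨1, 1, identity a.1, fun _ => a.2, hC.identity_mem a.1,
        fun _ _ => ⟨fun _ => rfl, fun _ => trivial⟩, by simp [identity], by simp [identity]⟩
    refine h₁.disjoint_append hC (ih hU.2) ?_
    simpa using hU.1

/-- A word can be relabelled by pairwise distinct labels, through which all labellings factor. -/
theorem exists_nodup_labels (w : List (PointColor × β)) :
    ∃ w' : List (PointColor × Fin w.length),
      (w'.map Prod.snd).Nodup ∧ w.map Prod.fst = w'.map Prod.fst ∧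
      ∀ (ε : Type) (F : β → ε), ∃ G : Fin w.length → ε,
        (w.map Prod.snd).map F = (w'.map Prod.snd).map G := by
  refine ⟨List.ofFn fun i => (w[i].1, i), ?_, ?_, fun ε F => ⟨fun i => F w[i].2, ?_⟩⟩
  · rw [List.map_ofFn, List.nodup_ofFn]
    exact fun _ _ h => h
  · apply List.ext_getElem <;> simp
  · apply List.ext_getElem <;> simp

/-- Part `t` of a word is replaced by the lower row of a partition with upper row `T`. -/
theorem Mem.substitute (hC : IsCategory C) {u t v : List (PointColor × β)}
    {T R : List (PointColor × γ)} (h : Mem C [] (u ++ t ++ v)) (h' : Mem C T R)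
    (ht : t.map Prod.fst = T.map Prod.fst) :
    ∃ (δ : Type) (F : β → δ) (G : γ → δ),
      Mem C [] (ColoredPartition.relabel F u ++ ColoredPartition.relabel G R ++
        ColoredPartition.relabel F v) ∧
      (t.map Prod.snd).map F = (T.map Prod.snd).map G ∧
      ∀ (ε : Type) (F' : β → ε) (G' : γ → ε),
        (t.map Prod.snd).map F' = (T.map Prod.snd).map G' →
          ∃ φ : δ → ε, (∀ x, φ (F x) = F' x) ∧ ∀ x, φ (G x) = G' x := by
  obtain ⟨u', hu, hu₁, hu₂⟩ := exists_nodup_labels u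
  obtain ⟨v', hv, hv₁, hv₂⟩ := exists_nodup_labels v
  -- The partition acts on the middle part only, flanked by identities on `u` and `v`. Their labels
  -- are chosen distinct, so that the identities merge no blocks.
  have hq := ((Mem.identities hC hu).tensor hC h').tensor hC (Mem.identities hC hv)
  obtain ⟨δ, F, G, h₁, h₂, h₃⟩ := h.comp hC hq (by simp [ht, hu₁, hv₁])
  simp only [relabel_append, relabel_relabel, map_snd_relabel, List.map_append, List.map_map]
    at h₁ h₂ h₃
  have lu : u.length = u'.length := by simpa using congrArg List.length hu₁
  have lt : t.length = T.length := by simpa using congrArg List.length ht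
  have h₂' := List.append_inj h₂ (by simp [lu, lt])
  have h₂'' := List.append_inj h₂'.1 (by simp [lu])
  refine ⟨δ, F, fun x => G (Sum.inl (Sum.inr x)), ?_, ?_, ?_⟩
  · rw [relabel_eq_of_map_eq hu₁ (F := F) (G := fun x => G (Sum.inl (Sum.inl x))),
      relabel_eq_of_map_eq hv₁ (F := F) (G := fun x => G (Sum.inr x))]
    · exact h₁
    · simpa [Function.comp_def] using h₂'.2
    · simpa [Function.comp_def] using h₂''.1
  · simpa [Function.comp_def] using h₂''.2
  · intro ε F' G' hFG
    obtain ⟨Gu, hGu⟩ := hu₂ ε F'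
    obtain ⟨Gv, hGv⟩ := hv₂ ε F'
    simp only [List.map_map, Function.comp_def] at hGu hGv hFG
    obtain ⟨φ, h₁, h₂⟩ := h₃ ε F' (Sum.elim (Sum.elim Gu G') Gv)
      (by simp [Function.comp_def, hGu, hGv, hFG])
    exact ⟨φ, h₁, fun x => h₂ _⟩

/-! ### Reflecting, bending, gluing and rotating words on one row -/

/-- The word read backwards with inverted colors. -/
def reflect (w : List (PointColor × β)) : List (PointColor × β) :=
  (w.map (Prod.map PointColor.flip id)).reverse

@[simp] theorem _root_.PointColor.flip_flip (c : PointColor) : c.flip.flip = c := by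
  cases c <;> rfl

@[simp] theorem reflect_nil : reflect ([] : List (PointColor × β)) = [] := rfl

@[simp] theorem reflect_cons (a : PointColor × β) (w : List (PointColor × β)) :
    reflect (a :: w) = reflect w ++ [(a.1.flip, a.2)] := by
  simp [reflect, Prod.map]

@[simp] theorem reflect_append (v w : List (PointColor × β)) :
    reflect (v ++ w) = reflect w ++ reflect v := by
  simp [reflect]

@[simp] theorem reflect_reflect (w : List (PointColor × β)) : reflect (reflect w) = w := by
  induction w <;> simp_all

@[simp] theorem relabel_reflect (F : β → γ) (w : List (PointColor × β)) :
    ColoredPartition.relabel F (reflect w) = reflect (ColoredPartition.relabel F w) := by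
  induction w <;> simp_all

@[simp] theorem map_snd_reflect (w : List (PointColor × β)) :
    (reflect w).map Prod.snd = (w.map Prod.snd).reverse := by
  induction w <;> simp_all

theorem map_fst_reflect (w : List (PointColor × β)) :
    (reflect w).map Prod.fst = ((w.map Prod.fst).map PointColor.flip).reverse := by
  induction w <;> simp_all

/-- Insertion of a word into another one with disjoint labels. -/
theorem Mem.insert (hC : IsCategory C) {u v w : List (PointColor × β)}
    (h : Mem C [] (u ++ v)) (h' : Mem C [] w)
    (hd : ∀ x ∈ (u ++ v).map Prod.snd, x ∉ w.map Prod.snd) : Mem C [] (u ++ w ++ v) := by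
  obtain ⟨δ, F, G, h₁, -, h₃⟩ :=
    Mem.substitute hC (u := u) (t := []) (v := v) (by simpa using h) h' rfl
  -- Nothing is glued, so any two labellings are compatible. The resulting `φ` is a left inverse of
  -- both `F` and `G`.
  obtain ⟨φ, hF, hG⟩ := h₃ β (fun x => x) (fun x => x) rfl
  have := h₁.relabel φ ?_
  · simpa [hF, hG] using this
  · intro x hx y hy hxy
    have split : ∀ x ∈ List.map Prod.snd ([] ++ (ColoredPartition.relabel F u ++
        ColoredPartition.relabel G w ++ ColoredPartition.relabel F v)),
        (∃ z ∈ (u ++ v).map Prod.snd, x = F z) ∨ (∃ z ∈ w.map Prod.snd, x = G z) := by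
      intro x hx
      simp only [List.nil_append, map_snd_relabel, List.map_append, List.mem_append,
        List.mem_map] at hx ⊢
      grind
    obtain ⟨z, hz, rfl⟩ | ⟨z, hz, rfl⟩ := split x hx <;>
      obtain ⟨z', hz', rfl⟩ | ⟨z', hz', rfl⟩ := split y hy <;> simp only [hF, hG] at hxy <;> grind

/-- Nested pairs. -/
theorem Mem.nest (hC : IsCategory C) {U : List (PointColor × β)}
    (hU : (U.map Prod.snd).Nodup) : Mem C [] (U ++ reflect U) := by
  induction U using List.reverseRecOn with
  | nil => exact Mem.nil hC
  | append_singleton U a ih =>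
    simp only [List.map_append, List.map_cons, List.map_nil, List.nodup_append] at hU
    have := (ih hU.1).insert hC (Mem.pair hC a.1 a.2) (by simp at hU ⊢; grind)
    simpa using this

/-- All upper points are moved to the lower row. -/
theorem Mem.bend (hC : IsCategory C) {U V : List (PointColor × β)} (h : Mem C U V) :
    Mem C [] (V ++ reflect U) := by
  obtain ⟨w, hw, hwU, hw'⟩ := exists_nodup_labels U
  -- In `w ++ reflect w`, the first half is replaced by the lower row `V`, while the second half
  -- inherits the labels of `U`.
  obtain ⟨δ, F, G, h₁, h₂, h₃⟩ := Mem.substitute hC (u := []) (t := w)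
    (v := ColoredPartition.reflect w) (by simpa using Mem.nest hC hw) h hwU.symm
  obtain ⟨g, hg⟩ := hw' β fun x => x
  obtain ⟨φ, hF, hG⟩ := h₃ β g (fun x => x) hg.symm
  rw [relabel_reflect, relabel_eq_of_map_eq hwU.symm h₂, ← relabel_reflect] at h₁
  simp only [relabel_nil, List.nil_append, ← relabel_append] at h₁
  have := h₁.relabel φ ?_
  · simpa only [relabel_relabel, relabel_nil, hG, relabel_id] using this
  · intro x hx y hy hxy
    simp only [List.nil_append, map_snd_relabel, List.mem_map] at hx hy
    obtain ⟨x, -, rfl⟩ := hx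
    obtain ⟨y, -, rfl⟩ := hy
    rw [hG, hG] at hxy
    rw [hxy]

theorem Mem.reflect (hC : IsCategory C) {w : List (PointColor × β)} (h : Mem C [] w) :
    Mem C [] (ColoredPartition.reflect w) := by
  simpa using (h.adjoint hC).bend hC

/-- The part `t` of the first word is cancelled against the part `t'` of the second one. -/
theorem Mem.glue (hC : IsCategory C) {u t v : List (PointColor × β)}
    {t' s : List (PointColor × γ)} (h : Mem C [] (u ++ t ++ v)) (h' : Mem C [] (t' ++ s))
    (ht : t.map Prod.fst = (ColoredPartition.reflect t').map Prod.fst) :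
    ∃ (δ : Type) (F : β → δ) (G : γ → δ),
      Mem C [] (ColoredPartition.relabel F u ++ ColoredPartition.relabel G s ++
        ColoredPartition.relabel F v) ∧
      (t.map Prod.snd).map F = (t'.map Prod.snd).reverse.map G ∧
      ∀ (ε : Type) (F' : β → ε) (G' : γ → ε),
        (t.map Prod.snd).map F' = (t'.map Prod.snd).reverse.map G' →
          ∃ φ : δ → ε, (∀ x, φ (F x) = F' x) ∧ ∀ x, φ (G x) = G' x := by
  -- The second word is inserted directly behind `t`. Then `t` and `t'` are adjacent and can be
  -- closed by nested pairs turned upside down.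
  obtain ⟨δ, F, G, h₁, -, h₃⟩ :=
    Mem.substitute hC (u := u ++ t) (t := []) (v := v) (by simpa using h) h' rfl
  obtain ⟨w, hw, hwt', hw'⟩ := exists_nodup_labels t
  have hwt := hwt'.symm
  have hN := (Mem.nest hC hw).adjoint hC
  obtain ⟨ε, F₂, G₂, k₁, k₂, k₃⟩ := Mem.substitute hC
    (u := ColoredPartition.relabel F u)
    (t := ColoredPartition.relabel F t ++ ColoredPartition.relabel G t')
    (v := ColoredPartition.relabel G s ++ ColoredPartition.relabel F v)
    (by simpa using h₁) hN (by
      have : t'.map Prod.fst = ((t.map Prod.fst).map PointColor.flip).reverse := by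
        rw [ht, map_fst_reflect]; simp [Function.comp_def]
      simp only [List.map_append, map_fst_relabel, this, map_fst_reflect, hwt])
  simp only [map_snd_relabel, map_snd_reflect, List.map_append, List.map_map, List.map_reverse]
    at k₂ k₃
  have hl : t.length = w.length := by simpa using (congrArg List.length hwt).symm
  have k₂' := List.append_inj k₂ (by simp [hl])
  refine ⟨ε, fun x => F₂ (F x), fun x => F₂ (G x), by simpa using k₁, ?_, ?_⟩
  · have e := k₂'.2
    rw [← k₂'.1] at e
    simpa [Function.comp_def] using (congrArg List.reverse e).symm
  · intro ζ F' G' hFG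
    obtain ⟨φ, hφF, hφG⟩ := h₃ ζ F' G' rfl
    obtain ⟨g, hg⟩ := hw' ζ F'
    obtain ⟨ψ, hψF, hψG⟩ := k₃ ζ φ g (by
      simp only [List.map_map, Function.comp_def] at hg hFG
      simp only [Function.comp_def, hφF, hφG, ← hg]
      congr 1
      simpa [Function.comp_def] using (congrArg List.reverse hFG).symm)
    exact ⟨ψ, fun x => by simp [hψF, hφF], fun x => by simp [hψF, hφG]⟩

@[simp] theorem _root_.PointColor.flip_white : PointColor.white.flip = PointColor.black := rfl

@[simp] theorem _root_.PointColor.flip_black : PointColor.black.flip = PointColor.white := rfl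

/-- Enclosing `a w` in a pair gives `ā a w a`. Closing the first two letters by a pair removes them
and hands the block of the old `a` over to the new one. -/
theorem Mem.rotate_cons (hC : IsCategory C) {a : PointColor × β} {w : List (PointColor × β)}
    (h : Mem C [] (a :: w)) : Mem C [] (w ++ [a]) := by
  have h₁ : Mem C [] (ColoredPartition.relabel some (a :: w)) :=
    h.relabel some fun _ _ _ _ h => Option.some_injective _ h
  have h₂ := Mem.insert hC (u := [(a.1.flip, none)]) (v := [(a.1.flip.flip, none)])
    (Mem.pair hC a.1.flip none) h₁ (by simp)
  obtain ⟨δ, F, G, h₃, h₄, h₅⟩ := Mem.glue hC (u := []) (t := [(a.1.flip, none), (a.1, some a.2)])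
    (v := ColoredPartition.relabel some w ++ [(a.1, none)]) (by simpa using h₂)
    (t' := [(a.1.flip, ()), (a.1.flip.flip, ())]) (s := [])
    (by simpa using Mem.pair hC a.1.flip ()) (by simp)
  obtain ⟨φ, hF, -⟩ := h₅ β (fun x => x.getD a.2) (fun _ => a.2) (by simp)
  have h₆ : F none = F (some a.2) := by simp at h₄; rw [h₄.1, h₄.2]
  have := h₃.relabel φ ?_
  · simpa [hF] using this
  · have split : ∀ x ∈ (ColoredPartition.relabel F (ColoredPartition.relabel some w ++
        [(a.1, none)])).map Prod.snd, ∃ z, x = F (some z) := by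
      intro x hx
      simp only [map_snd_relabel, List.map_append, List.mem_append, List.mem_map] at hx
      grind
    intro x hx y hy hxy
    obtain ⟨x, rfl⟩ := split x (by simpa using hx)
    obtain ⟨y, rfl⟩ := split y (by simpa using hy)
    simp only [hF, Option.getD_some] at hxy
    rw [hxy]

theorem Mem.rotate (hC : IsCategory C) {u v : List (PointColor × β)}
    (h : Mem C [] (u ++ v)) : Mem C [] (v ++ u) := by
  induction u generalizing v with
  | nil => simpa using h
  | cons a u ih =>
    have := ih (v := v ++ [a]) (by simpa using h.rotate_cons hC)
    simpa using this

theorem Mem.of_isRotated (hC : IsCategory C) {u v : List (PointColor × β)}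
    (h : Mem C [] u) (huv : u ~r v) : Mem C [] v := by
  obtain ⟨n, hn, rfl⟩ := List.isRotated_iff_mod.1 huv
  rw [List.rotate_eq_drop_append_take hn]
  exact Mem.rotate hC (by simpa using h)

/-! ### In case 𝒪 every block has exactly two legs -/

/-- If `a` were a singleton block, cancelling `x` against its reflection would leave only `a` and
its inverse, still in separate blocks. -/
theorem Mem.snd_mem_of_cons (hC : IsCaseO C) {a : PointColor × β} {x : List (PointColor × β)}
    (h : Mem C [] (a :: x)) : a.2 ∈ x.map Prod.snd := by
  by_contra ha
  have hCC := hC.toIsCategory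
  obtain ⟨δ, F, G, h₁, -, h₃⟩ := Mem.glue hCC (u := [a]) (t := x) (v := [])
    (by simpa using h) (t' := ColoredPartition.reflect x) (s := [(a.1.flip, a.2)])
    (by simpa using h.reflect hCC) (by simp)
  -- The labelling by "equals `a.2`" is false on all of `x`, hence compatible with the constant
  -- `False` on the reflected word. It separates the two remaining letters.
  obtain ⟨φ, hF, hG⟩ := h₃ Prop (fun y => y = a.2) (fun _ => False) (by
    simp only [map_snd_reflect, List.reverse_reverse]
    refine List.map_congr_left fun y hy => ?_
    simp only [eq_iff_iff, iff_false]
    rintro rfl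
    exact ha hy)
  have hne : F a.2 ≠ G a.2 := fun e => by
    have := congrArg φ e
    simp [hF, hG] at this
  have key : ∀ x y : δ, x ≠ y → ¬ Mem C [] [(PointColor.white, x), (PointColor.black, y)] := by
    intro x y hxy h
    refine hC.lowerSingletons_notMem
      (h.sigma_mem lowerSingletons (Sum.elim Fin.elim0 ![x, y]) ?_ (by simp)
        (by simp [lowerSingletons]))
    intro P Q
    rcases P with P | P
    · exact P.elim0
    rcases Q with Q | Q
    · exact Q.elim0
    change Sum.inr P = Sum.inr Q ↔ _
    fin_cases P <;> fin_cases Q <;> simp [hxy, hxy.symm]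
  obtain ⟨c, l⟩ := a
  cases c with
  | white => exact key _ _ hne (by simpa using h₁)
  | black =>
    have h₁ : Mem C [] [(PointColor.black, F l), (PointColor.white, G l)] := by simpa using h₁
    exact key _ _ hne.symm (h₁.rotate_cons hCC)

theorem not_mem_four (hC : IsCaseO C) (c : PointColor) (x : β) :
    ¬ Mem C [] [(c, x), (c.flip, x), (c, x), (c.flip, x)] := by
  have key : ¬ Mem C [] [(PointColor.white, x), (PointColor.black, x), (PointColor.white, x),
      (PointColor.black, x)] := fun h =>
    hC.lowerFourBlock_notMem (h.sigma_mem lowerFourBlock (fun _ => x)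
      (fun _ _ => ⟨fun _ => rfl, fun _ => trivial⟩) (by simp) (by simp [lowerFourBlock]))
  intro h
  cases c with
  | white => exact key h
  | black => exact key (h.rotate_cons hC.toIsCategory)

/-- Cancelling `R` against its reflection leaves `b b̄ L̄ L`. Both `b` and `b̄` are in one block
because `R` contains a leg of it. Cancelling `L` against the reflection of this word gives `b b̄ L̄
L b b̄`, where the leg in `L` joins the two outer pairs. Closing `L̄ L` by nested pairs leaves the
forbidden four-block. -/
theorem not_mem_triple (hC : IsCaseO C) {b : PointColor × β} {R L : List (PointColor × β)}
    (hR : b.2 ∈ R.map Prod.snd) (hL : b.2 ∈ L.map Prod.snd) : ¬ Mem C [] (b :: R ++ L) := by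
  intro h
  have hCC := hC.toIsCategory
  obtain ⟨δ, F, G, h₁, h₂, -⟩ := Mem.glue hCC (u := [b]) (t := R) (v := L)
    (by simpa using h) (t' := ColoredPartition.reflect R)
    (s := (b.1.flip, b.2) :: ColoredPartition.reflect L)
    (by
      have := Mem.rotate hCC (u := ColoredPartition.reflect L)
        (v := ColoredPartition.reflect R ++ [(b.1.flip, b.2)]) (by simpa using h.reflect hCC)
      simpa using this) (by simp)
  have hFG : F b.2 = G b.2 := by
    simp only [map_snd_reflect, List.reverse_reverse] at h₂
    exact List.map_inj_left.1 h₂ _ hR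
  obtain ⟨c, l⟩ := b
  simp only [relabel_nil, relabel_cons, ← hFG, relabel_reflect] at h₁ hL
  set L₁ := ColoredPartition.relabel F L with hL₁
  set L₂ := ColoredPartition.relabel G L
  have hL' : F l ∈ L₁.map Prod.snd := by
    rw [hL₁, map_snd_relabel]
    exact List.mem_map_of_mem hL
  obtain ⟨δ', F', G', k₁, k₂, -⟩ := Mem.glue hCC
    (u := (c, F l) :: (c.flip, F l) :: ColoredPartition.reflect L₂) (t := L₁) (v := [])
    (by simpa using h₁) (t' := ColoredPartition.reflect L₁)
    (s := L₂ ++ [(c, F l), (c.flip, F l)]) (by simpa using h₁.reflect hCC) (by simp)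
  have hFG' : F' (F l) = G' (F l) := by
    simp only [map_snd_reflect, List.reverse_reverse] at k₂
    exact List.map_inj_left.1 k₂ _ hL'
  -- For closing by nested pairs only the colors of `L₂` matter; the pairs get labels of their own.
  obtain ⟨L₃, hL₃, hc, -⟩ := exists_nodup_labels L₂
  obtain ⟨δ'', F'', G'', e₁, -, -⟩ := Mem.glue hCC
    (u := [(c, F' (F l)), (c.flip, F' (F l))])
    (t := ColoredPartition.reflect (ColoredPartition.relabel F' L₂) ++
      ColoredPartition.relabel G' L₂)
    (v := [(c, F' (F l)), (c.flip, F' (F l))])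
    (by simpa [← hFG'] using k₁)
    (t' := ColoredPartition.reflect L₃ ++ ColoredPartition.reflect (ColoredPartition.reflect L₃))
    (s := []) (by simpa using Mem.nest hCC (U := ColoredPartition.reflect L₃) (by simpa using hL₃))
    (by simp [map_fst_reflect, hc])
  exact not_mem_four hC c _ (by simpa using e₁)

open Classical in
theorem Mem.count_eq_two (hC : IsCaseO C) {w : List (PointColor × β)} (h : Mem C [] w) {l : β}
    (hl : l ∈ w.map Prod.snd) : (w.map Prod.snd).count l = 2 := by
  obtain ⟨b, hb, rfl⟩ := List.mem_map.1 hl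
  obtain ⟨w₁, w₂, rfl⟩ := List.append_of_mem hb
  have h₁ : Mem C [] (b :: (w₂ ++ w₁)) := by simpa using h.rotate hC.toIsCategory
  obtain ⟨y, hy, hyb⟩ := List.mem_map.1 (h₁.snd_mem_of_cons hC)
  obtain ⟨R, L, hRL⟩ := List.append_of_mem hy
  have h₂ : b.2 ∉ L.map Prod.snd := fun hL => by
    refine not_mem_triple hC (b := b) (R := R ++ [y]) (L := L) (by simp [hyb]) hL ?_
    simpa [hRL] using h₁
  have h₃ : b.2 ∉ R.map Prod.snd := fun hR => by
    refine not_mem_triple hC (b := b) (R := R) (L := y :: L) hR (by simp [hyb]) ?_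
    simpa [hRL] using h₁
  have e : ((w₁ ++ b :: w₂).map Prod.snd).count b.2 =
      ((w₂ ++ w₁).map Prod.snd).count b.2 + 1 := by
    simp only [List.map_append, List.map_cons, List.count_append, List.count_cons_self]
    omega
  rw [e, hRL]
  simp only [List.map_append, List.map_cons, List.count_append, ← hyb, List.count_cons_self]
  rw [hyb, List.count_eq_zero.2 h₂, List.count_eq_zero.2 h₃]

/-! ### Cyclic order and lists of points -/

variable {k l : ℕ}

/-- All points in counter-clockwise order. -/
def points (k l : ℕ) : List (Fin k ⊕ Fin l) :=
  List.ofFn Sum.inr ++ (List.ofFn Sum.inl).reverse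

theorem mem_points (x : Fin k ⊕ Fin l) : x ∈ points k l := by
  rcases x with i | i <;> simp [points]

theorem pairwise_points : (points k l).Pairwise (fun x y => position x < position y) := by
  rw [points, List.pairwise_append, List.pairwise_reverse, List.pairwise_ofFn, List.pairwise_ofFn]
  refine ⟨fun i j hij => hij, fun i j hij => ?_, ?_⟩
  · simp only [position]
    have := j.2
    have : (i : ℕ) < j := hij
    omega
  · intro x hx y hy
    obtain ⟨i, rfl⟩ := List.mem_ofFn.1 hx
    obtain ⟨j, rfl⟩ := List.mem_ofFn.1 (List.mem_reverse.1 hy)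
    simp only [position]
    have := i.2
    omega

theorem Ordered.rotate {a b c : Fin k ⊕ Fin l} (h : Ordered a b c) : Ordered b c a := by
  simp only [Ordered] at h ⊢
  omega

theorem Ordered.not_swap {a b c : Fin k ⊕ Fin l} (h : Ordered a b c) : ¬ Ordered a c b := by
  simp only [Ordered] at h ⊢
  omega

theorem Ordered.ne {a b c : Fin k ⊕ Fin l} (h : Ordered a b c) : a ≠ b ∧ b ≠ c ∧ a ≠ c := by
  refine ⟨?_, ?_, ?_⟩ <;> rintro rfl <;> simp only [Ordered] at h <;> omega

/-- Lists that run once through all points in counter-clockwise order. -/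
structure IsTour (P : List (Fin k ⊕ Fin l)) : Prop where
  isRotated : points k l ~r P

namespace IsTour
variable {P u v xs vs : List (Fin k ⊕ Fin l)} {α β : Fin k ⊕ Fin l}

theorem points : IsTour (points k l) := ⟨List.IsRotated.refl _⟩

theorem rotate (h : IsTour (u ++ v)) : IsTour (v ++ u) :=
  ⟨h.isRotated.trans List.isRotated_append⟩

theorem mem (h : IsTour P) (x : Fin k ⊕ Fin l) : x ∈ P := h.isRotated.mem_iff.1 (mem_points x)

theorem nodup (h : IsTour P) : P.Nodup :=
  h.isRotated.nodup_iff.1 (pairwise_points.imp fun h e => by rw [e] at h; exact lt_irrefl _ h)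

/-- A rotation exchanges two pieces of the list `points`. However the triple is split between them,
a cyclic permutation of it has increasing positions. -/
theorem ordered (h : IsTour P) {a b c : Fin k ⊕ Fin l} (habc : [a, b, c].Sublist P) :
    Ordered a b c := by
  have base : ∀ a b c, [a, b, c].Sublist (ColoredPartition.points k l) → Ordered a b c := by
    intro a b c h
    have := (pairwise_points (k := k) (l := l)).sublist h
    simp only [List.pairwise_cons, List.mem_cons] at this
    exact Or.inl ⟨this.1 _ (by simp), this.2.1 _ (by simp)⟩
  obtain ⟨n, hn, rfl⟩ := List.isRotated_iff_mod.1 h.isRotated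
  rw [List.rotate_eq_drop_append_take hn] at habc
  obtain ⟨l₁, l₂, e, h₁, h₂⟩ := List.sublist_append_iff.1 habc
  have h₃ : (l₂ ++ l₁).Sublist (ColoredPartition.points k l) := by
    simpa using h₂.append h₁
  rcases l₁ with _ | ⟨x, _ | ⟨y, _ | ⟨z, _ | _⟩⟩⟩
  · simp only [List.nil_append] at e
    subst e
    exact base _ _ _ (by simpa using h₃)
  · simp only [List.cons_append, List.nil_append, List.cons.injEq] at e
    obtain ⟨rfl, rfl⟩ := e
    exact (base _ _ _ h₃).rotate.rotate
  · simp only [List.cons_append, List.nil_append, List.cons.injEq] at e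
    obtain ⟨rfl, rfl, rfl⟩ := e
    exact (base _ _ _ h₃).rotate
  · simp only [List.cons_append, List.nil_append, List.cons.injEq, List.nil_eq] at e
    obtain ⟨rfl, rfl, rfl, rfl⟩ := e
    exact base _ _ _ h₃
  · simp at e

theorem mem_iff (h : IsTour (α :: xs ++ β :: vs)) (x : Fin k ⊕ Fin l) :
    x ∈ xs ↔ x ∈ openInterval α β := by
  constructor
  · intro hx
    exact h.ordered (((List.singleton_sublist.2 hx).append
      ((List.nil_sublist vs).cons_cons β)).cons_cons α)
  · intro hx
    have hne := Ordered.ne hx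
    have := h.mem x
    simp only [List.cons_append, List.mem_cons, List.mem_append] at this
    obtain rfl | hx' | rfl | hx' := this
    · exact absurd rfl hne.1
    · exact hx'
    · exact absurd rfl hne.2.1
    · exact absurd (h.ordered ((((List.nil_sublist xs).append
        ((List.singleton_sublist.2 hx').cons_cons β))).cons_cons α)) (Ordered.not_swap hx)

theorem exists_of_ne (hne : α ≠ β) : ∃ xs vs, IsTour (α :: xs ++ β :: vs) := by
  obtain ⟨u, w, h⟩ := List.append_of_mem (mem_points α)
  have h₁ : IsTour (α :: (w ++ u)) := by
    have : IsTour (u ++ α :: w) := h ▸ points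
    exact this.rotate
  have hβ := h₁.mem β
  rw [List.mem_cons, or_iff_right hne.symm] at hβ
  obtain ⟨xs, vs, e⟩ := List.append_of_mem hβ
  exact ⟨xs, vs, by rwa [e] at h₁⟩

end IsTour

/-! ### Color sums and color distances of words -/

/-- The color sum of a word. -/
def wordSum (w : List (PointColor × β)) : ℤ := (w.map fun a => a.1.weight).sum

@[simp] theorem wordSum_nil : wordSum ([] : List (PointColor × β)) = 0 := rfl

@[simp] theorem wordSum_cons (a : PointColor × β) (w) :
    wordSum (a :: w) = a.1.weight + wordSum w := by simp [wordSum]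

@[simp] theorem wordSum_append (v w : List (PointColor × β)) :
    wordSum (v ++ w) = wordSum v + wordSum w := by simp [wordSum]

@[simp] theorem _root_.PointColor.weight_flip (c : PointColor) : c.flip.weight = -c.weight := by
  cases c <;> rfl

@[simp] theorem wordSum_reflect (w : List (PointColor × β)) : wordSum (reflect w) = -wordSum w := by
  induction w <;> simp_all

@[simp] theorem wordSum_relabel (F : β → γ) (w : List (PointColor × β)) :
    wordSum (relabel F w) = wordSum w := by
  induction w <;> simp_all

open Classical in
/-- The color distance of two points of colors `c` and `d` with color sum `s` in between. -/
noncomputable def wordDist (c : PointColor) (s : ℤ) (d : PointColor) : ℤ :=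
  if c = d then s + d.weight else s

theorem colorSum_eq (p : ColoredPartition k l) {S : Set (Fin k ⊕ Fin l)}
    {P : List (Fin k ⊕ Fin l)} (hP : P.Nodup) (h : ∀ x, x ∈ P ↔ x ∈ S) :
    p.colorSum S = (P.map fun x => (p.normalizedColor x).weight).sum := by
  classical
  rw [colorSum, ← List.sum_toFinset _ hP]
  simp only [Set.indicator_apply, ← h]
  rw [← Finset.sum_filter]
  congr 1
  ext x
  simp

/-- The word of a partition with labels `f`, read along a list of points. -/
def word (p : ColoredPartition k l) (f : Fin k ⊕ Fin l → β) (P : List (Fin k ⊕ Fin l)) :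
    List (PointColor × β) :=
  P.map fun x => (p.normalizedColor x, f x)

theorem IsTour.colorDist_eq {xs vs : List (Fin k ⊕ Fin l)} {α₁ α₂ : Fin k ⊕ Fin l}
    (h : IsTour (α₁ :: xs ++ α₂ :: vs)) (p : ColoredPartition k l) (f : Fin k ⊕ Fin l → β) :
    p.colorDist α₁ α₂ = wordDist (p.normalizedColor α₁) (wordSum (word p f xs))
      (p.normalizedColor α₂) := by
  have hn := h.nodup
  simp only [List.cons_append, List.nodup_cons, List.nodup_append, List.mem_cons] at hn
  have hw : wordSum (word p f xs) = (xs.map fun x => (p.normalizedColor x).weight).sum := by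
    simp [wordSum, word, Function.comp_def]
  rw [colorDist, wordDist, hw]
  split_ifs with hc
  · rw [colorSum_eq p (P := α₂ :: xs)]
    · simp [add_comm]
    · simp only [List.nodup_cons]
      exact ⟨fun hx => hn.2.2.2 _ hx _ (Or.inl rfl) rfl, hn.2.1⟩
    · intro x
      rw [List.mem_cons, Set.mem_insert_iff, h.mem_iff]
  · exact colorSum_eq p hn.2.1 h.mem_iff

theorem colorSum_pair (p : ColoredPartition k l) {α₁ α₂ : Fin k ⊕ Fin l} (h : α₁ ≠ α₂) :
    p.colorSum {α₁, α₂} = 0 ↔ p.normalizedColor α₂ = (p.normalizedColor α₁).flip := by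
  rw [colorSum_eq p (P := [α₁, α₂]) (by simpa using h) (by simp)]
  simp only [List.map_cons, List.map_nil, List.sum_cons, List.sum_nil]
  generalize p.normalizedColor α₁ = c
  generalize p.normalizedColor α₂ = d
  cases c <;> cases d <;> simp [PointColor.weight]

/-! ### Translation of blocks, crossings and parameters between partitions and words -/

theorem mem_word (hC : IsCategory C) {p : ColoredPartition k l}
    (hp : (⟨k, l, p⟩ : AnyColoredPartition) ∈ C) {f : Fin k ⊕ Fin l → β}
    (hf : ∀ x y, p.rel x y ↔ f x = f y) {P : List (Fin k ⊕ Fin l)} (hP : IsTour P) :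
    Mem C [] (word p f P) := by
  have h := Mem.bend hC ⟨k, l, p, f, hp, hf, rfl, rfl⟩
  refine h.of_isRotated hC ?_
  have e : List.ofFn (fun j => (p.lower j, f (Sum.inr j))) ++
      reflect (List.ofFn (fun i => (p.upper i, f (Sum.inl i)))) = word p f (points k l) := by
    simp [word, points, reflect, List.map_ofFn, Function.comp_def, normalizedColor]
  rw [e]
  exact hP.isRotated.map _

theorem exists_eq_word {w : List (PointColor × β)} (h : Mem C [] w) :
    ∃ (k l : ℕ) (p : ColoredPartition k l) (f : Fin k ⊕ Fin l → β),
      (⟨k, l, p⟩ : AnyColoredPartition) ∈ C ∧ (∀ x y, p.rel x y ↔ f x = f y) ∧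
      w = word p f (points k l) := by
  obtain ⟨k, l, p, f, hp, hf, hU, rfl⟩ := h
  obtain rfl : k = 0 := by simpa using (congrArg List.length hU).symm
  exact ⟨0, l, p, f, hp, hf, by
    simp [word, points, List.map_ofFn, Function.comp_def, normalizedColor]⟩

/-- Splits a word along two of its letters. -/
theorem exists_tour {a b : PointColor × β} {x v : List (PointColor × β)}
    (h : Mem C [] (a :: x ++ b :: v)) :
    ∃ (k l : ℕ) (p : ColoredPartition k l) (f : Fin k ⊕ Fin l → β),
      (⟨k, l, p⟩ : AnyColoredPartition) ∈ C ∧ (∀ x y, p.rel x y ↔ f x = f y) ∧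
      ∃ α₁ xs α₂ vs, IsTour (α₁ :: xs ++ α₂ :: vs) ∧ a = (p.normalizedColor α₁, f α₁) ∧
        x = word p f xs ∧ b = (p.normalizedColor α₂, f α₂) ∧ v = word p f vs := by
  obtain ⟨k, l, p, f, hp, hf, hw⟩ := exists_eq_word h
  refine ⟨k, l, p, f, hp, hf, ?_⟩
  rw [word, List.cons_append, eq_comm, List.map_eq_cons_iff] at hw
  obtain ⟨α₁, P, hP, hα₁, hw⟩ := hw
  obtain ⟨xs, P', rfl, hxs, hw⟩ := List.map_eq_append_iff.1 hw
  obtain ⟨α₂, vs, rfl, hα₂, hvs⟩ := List.map_eq_cons_iff.1 hw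
  exact ⟨α₁, xs, α₂, vs, by rw [List.cons_append, ← hP]; exact IsTour.points, hα₁.symm,
    hxs.symm, hα₂.symm, hvs.symm⟩

/-- `A` and `B` alternate (at least) twice in a cyclic sequence of labels. -/
def Alternate (A B : β) (L : List β) : Prop :=
  [A, B, A, B].Sublist L ∨ [B, A, B, A].Sublist L

/-- Cutting ABAB at an even place reproduces it, cutting at an odd place gives BABA. Hence both
patterns are admitted in `Alternate`. -/
theorem Alternate.rotate {A B : β} {u v : List β} (h : Alternate A B (u ++ v)) :
    Alternate A B (v ++ u) := by
  have key : ∀ A B : β, [A, B, A, B].Sublist (u ++ v) → Alternate A B (v ++ u) := by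
    intro A B h
    obtain ⟨l₁, l₂, e, h₁, h₂⟩ := List.sublist_append_iff.1 h
    have h₃ := h₂.append h₁
    rcases l₁ with _ | ⟨x, _ | ⟨y, _ | ⟨z, _ | ⟨t, _ | _⟩⟩⟩⟩ <;>
      simp only [List.cons_append, List.nil_append, List.cons.injEq, List.nil_eq, reduceCtorEq,
        and_false] at e
    · subst e; exact Or.inl (by simpa using h₃)
    · obtain ⟨rfl, rfl⟩ := e; exact Or.inr h₃
    · obtain ⟨rfl, rfl, rfl⟩ := e; exact Or.inl h₃
    · obtain ⟨rfl, rfl, rfl, rfl⟩ := e; exact Or.inr h₃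
    · obtain ⟨rfl, rfl, rfl, rfl, rfl⟩ := e; exact Or.inl h₃
  rcases h with h | h
  · exact key A B h
  · exact (key B A h).symm

theorem Alternate.of_isRotated {A B : β} {u v : List β} (h : Alternate A B u) (huv : u ~r v) :
    Alternate A B v := by
  obtain ⟨n, hn, rfl⟩ := List.isRotated_iff_mod.1 huv
  rw [List.rotate_eq_drop_append_take hn]
  exact Alternate.rotate (by simpa using h)

theorem mem_blocks_iff {p : ColoredPartition k l} {f : Fin k ⊕ Fin l → β}
    (hf : ∀ x y, p.rel x y ↔ f x = f y) {B : Set (Fin k ⊕ Fin l)} :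
    B ∈ p.blocks ↔ ∃ y, B = {x | f x = f y} := by
  simp only [blocks, Setoid.classes, Set.mem_ofPred_eq]
  refine exists_congr fun y => ?_
  have : {x | p.rel x y} = {x | f x = f y} := Set.ext fun x => hf x y
  rw [this]

theorem exists_labels (p : ColoredPartition k l) :
    ∃ (β : Type) (f : Fin k ⊕ Fin l → β), ∀ x y, p.rel x y ↔ f x = f y :=
  ⟨Quotient p.rel, Quotient.mk _, fun _ _ => Quotient.eq.symm⟩

theorem mem_params_of_mem {a b : PointColor × β} {x v : List (PointColor × β)}
    (h : Mem C [] (a :: x ++ b :: v)) (hab : a.2 = b.2) (hx : a.2 ∉ x.map Prod.snd) :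
    wordDist a.1 (wordSum x) b.1 ∈ paramL C ∪ paramK C := by
  obtain ⟨k, l, p, f, hp, hf, α₁, xs, α₂, vs, hT, rfl, rfl, rfl, rfl⟩ := exists_tour h
  have hne : α₁ ≠ α₂ := by
    rintro rfl
    have := hT.nodup
    simp at this
  have hB : {y | f y = f α₁} ∈ p.blocks := (mem_blocks_iff hf).2 ⟨α₁, rfl⟩
  have hd := hT.colorDist_eq p f
  have hI : openInterval α₁ α₂ ∩ {y | f y = f α₁} = ∅ := by
    ext y
    simp only [Set.mem_inter_iff, Set.mem_ofPred_eq, Set.mem_empty_iff_false, iff_false, not_and]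
    intro hy hfy
    rw [← hT.mem_iff] at hy
    refine hx (List.mem_map.2 ⟨(p.normalizedColor y, f y), List.mem_map_of_mem hy, hfy⟩)
  by_cases hs : p.colorSum {α₁, α₂} = 0
  · exact Or.inr ⟨k, l, p, hp, _, hB, α₁, rfl, α₂, hab.symm, hne, hI, hs, hd.symm⟩
  · exact Or.inl ⟨k, l, p, hp, _, hB, α₁, rfl, α₂, hab.symm, hne, hI, hs, hd.symm⟩

/-- That the legs are subsequent need not be recorded: in case 𝒪 it can be recovered from the fact
that blocks have two legs. -/
theorem exists_word_of_legs (hC : IsCategory C) {p : ColoredPartition k l}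
    (hp : (⟨k, l, p⟩ : AnyColoredPartition) ∈ C) {B : Set (Fin k ⊕ Fin l)} (hB : B ∈ p.blocks)
    {α₁ α₂ : Fin k ⊕ Fin l} (h₁ : α₁ ∈ B) (h₂ : α₂ ∈ B) (hne : α₁ ≠ α₂) :
    ∃ (β : Type) (L : β) (x v : List (PointColor × β)),
      Mem C [] ((p.normalizedColor α₁, L) :: x ++ (p.normalizedColor α₂, L) :: v) ∧
      p.colorDist α₁ α₂ =
        wordDist (p.normalizedColor α₁) (wordSum x) (p.normalizedColor α₂) := by
  obtain ⟨β, f, hf⟩ := exists_labels p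
  obtain ⟨xs, vs, hT⟩ := IsTour.exists_of_ne hne
  obtain ⟨y, rfl⟩ := (mem_blocks_iff hf).1 hB
  refine ⟨β, f y, word p f xs, word p f vs, ?_, hT.colorDist_eq p f⟩
  have h := mem_word hC hp hf hT
  have h₁ : f α₁ = f y := h₁
  have h₂ : f α₂ = f y := h₂
  simpa [word, h₁, h₂] using h

theorem exists_word_of_mem_paramK (hC : IsCategory C) {d : ℤ} (hd : d ∈ paramK C) :
    ∃ (β : Type) (c : PointColor) (L : β) (x v : List (PointColor × β)),
      Mem C [] ((c, L) :: x ++ (c.flip, L) :: v) ∧ wordDist c (wordSum x) c.flip = d := by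
  obtain ⟨k, l, p, hp, B, hB, α₁, h₁, α₂, h₂, hne, -, hs, rfl⟩ := hd
  obtain ⟨β, L, x, v, h, hd⟩ := exists_word_of_legs hC hp hB h₁ h₂ hne
  rw [colorSum_pair p hne] at hs
  rw [hs] at h hd
  exact ⟨β, _, L, x, v, h, hd.symm⟩

theorem exists_word_of_mem_paramL (hC : IsCategory C) {d : ℤ} (hd : d ∈ paramL C) :
    ∃ (β : Type) (c : PointColor) (L : β) (x v : List (PointColor × β)),
      Mem C [] ((c, L) :: x ++ (c, L) :: v) ∧ wordDist c (wordSum x) c = d := by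
  obtain ⟨k, l, p, hp, B, hB, α₁, h₁, α₂, h₂, hne, -, hs, rfl⟩ := hd
  obtain ⟨β, L, x, v, h, hd⟩ := exists_word_of_legs hC hp hB h₁ h₂ hne
  rw [ne_eq, colorSum_pair p hne] at hs
  have hs : p.normalizedColor α₂ = p.normalizedColor α₁ := by
    revert hs
    cases p.normalizedColor α₁ <;> cases p.normalizedColor α₂ <;> simp
  rw [hs] at h hd
  exact ⟨β, _, L, x, v, h, hd.symm⟩

theorem mem_paramX_of_mem {a b : PointColor × β} {x v : List (PointColor × β)}
    (h : Mem C [] (a :: x ++ b :: v)) (hab : a.2 ≠ b.2)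
    (hx : Alternate a.2 b.2 ((a :: x ++ b :: v).map Prod.snd)) :
    wordDist a.1 (wordSum x) b.1 ∈ paramX C := by
  obtain ⟨k, l, p, f, hp, hf, α₁, xs, α₂, vs, hT, rfl, rfl, rfl, rfl⟩ := exists_tour h
  have e : ((p.normalizedColor α₁, f α₁) :: word p f xs ++
      (p.normalizedColor α₂, f α₂) :: word p f vs).map Prod.snd =
      (α₁ :: xs ++ α₂ :: vs).map f := by
    simp [word, Function.comp_def]
  have key : ∀ A B : β, [A, B, A, B].Sublist ((α₁ :: xs ++ α₂ :: vs).map f) →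
      ∃ P₁ P₂ P₃ P₄, f P₁ = A ∧ f P₂ = B ∧ f P₃ = A ∧ f P₄ = B ∧ Ordered P₁ P₂ P₃ ∧
        Ordered P₃ P₄ P₁ := by
    intro A B hAB
    obtain ⟨Q, hQ, hQe⟩ := List.sublist_map_iff.1 hAB
    rcases Q with _ | ⟨P₁, _ | ⟨P₂, _ | ⟨P₃, _ | ⟨P₄, _ | _⟩⟩⟩⟩ <;> simp at hQe
    refine ⟨P₁, P₂, P₃, P₄, hQe.1.symm, hQe.2.1.symm, hQe.2.2.1.symm, hQe.2.2.2.symm,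
      hT.ordered (.trans ?_ hQ), (hT.ordered (.trans ?_ hQ)).rotate⟩
    · exact (((List.nil_sublist _).cons_cons _).cons_cons _).cons_cons _
    · exact ((List.Sublist.refl _).cons _).cons_cons _
  rw [e] at hx
  refine ⟨k, l, p, hp, {y | f y = f α₁}, (mem_blocks_iff hf).2 ⟨α₁, rfl⟩, {y | f y = f α₂},
    (mem_blocks_iff hf).2 ⟨α₂, rfl⟩, ⟨fun e => hab ?_, ?_⟩, α₁, rfl, α₂, rfl,
    (hT.colorDist_eq p f).symm⟩
  · exact (Set.ext_iff.1 e α₁).1 rfl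
  · rcases hx with hx | hx
    · obtain ⟨P₁, P₂, P₃, P₄, h₁, h₂, h₃, h₄, h₅, h₆⟩ := key _ _ hx
      exact ⟨P₁, h₁, P₃, h₃, P₂, h₂, P₄, h₄, h₅, h₆⟩
    · obtain ⟨P₁, P₂, P₃, P₄, h₁, h₂, h₃, h₄, h₅, h₆⟩ := key _ _ hx
      exact ⟨P₂, h₂, P₄, h₄, P₃, h₃, P₁, h₁, by simp only [Ordered] at *; omega,
        by simp only [Ordered] at *; omega⟩

theorem exists_word_of_mem_paramX (hC : IsCategory C) {d : ℤ} (hd : d ∈ paramX C) :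
    ∃ (β : Type) (a b : PointColor × β) (x v : List (PointColor × β)),
      Mem C [] (a :: x ++ b :: v) ∧ a.2 ≠ b.2 ∧
      Alternate a.2 b.2 ((a :: x ++ b :: v).map Prod.snd) ∧ wordDist a.1 (wordSum x) b.1 = d := by
  obtain ⟨k, l, p, hp, B₁, hB₁, B₂, hB₂, ⟨hB, β₁, hβ₁, γ₁, hγ₁, β₂, hβ₂, γ₂, hγ₂, o₁, o₂⟩,
    α₁, h₁, α₂, h₂, rfl⟩ := hd
  obtain ⟨β, f, hf⟩ := exists_labels p
  obtain ⟨y₁, rfl⟩ := (mem_blocks_iff hf).1 hB₁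
  obtain ⟨y₂, rfl⟩ := (mem_blocks_iff hf).1 hB₂
  have hf₁₂ : f y₁ ≠ f y₂ := fun e => hB (by rw [e])
  simp only [Set.mem_ofPred_eq] at hβ₁ hγ₁ hβ₂ hγ₂ h₁ h₂
  have hne : α₁ ≠ α₂ := by
    rintro rfl
    exact hf₁₂ (h₁.symm.trans h₂)
  -- Two tours are needed: one exhibits the distance from `α₁` to `α₂`, the other the crossing seen
  -- from `β₁`. They are rotations of each other, and alternation is invariant under rotation.
  obtain ⟨xs, vs, hT⟩ := IsTour.exists_of_ne hne
  obtain ⟨xs', vs', hT'⟩ := IsTour.exists_of_ne (Ordered.ne o₁).2.2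
  refine ⟨β, (p.normalizedColor α₁, f α₁), (p.normalizedColor α₂, f α₂), word p f xs, word p f vs,
    ?_, ?_, ?_, (hT.colorDist_eq p f).symm⟩
  · simpa [word] using mem_word hC hp hf hT
  · simpa [h₁, h₂] using hf₁₂
  · have e : ((p.normalizedColor α₁, f α₁) :: word p f xs ++
        (p.normalizedColor α₂, f α₂) :: word p f vs).map Prod.snd =
        (α₁ :: xs ++ α₂ :: vs).map f := by
      simp [word, Function.comp_def]
    rw [e]
    have hr := hT'.isRotated.symm.trans hT.isRotated
    refine Alternate.of_isRotated (Or.inl ?_) (hr.map f)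
    have m₁ : β₂ ∈ xs' := (hT'.mem_iff β₂).2 o₁
    have m₂ : γ₂ ∈ vs' := by
      have := hT'.rotate
      rw [List.cons_append, ← List.cons_append] at this
      exact (this.mem_iff γ₂).2 o₂
    have : [β₁, β₂, γ₁, γ₂].Sublist (β₁ :: xs' ++ γ₁ :: vs') :=
      ((List.singleton_sublist.2 m₁).append ((List.singleton_sublist.2 m₂).cons_cons γ₁)).cons_cons
        β₁
    simpa [hβ₁, hβ₂, hγ₁, hγ₂, h₁, h₂] using this.map f

/-! ### Shifting crossing distances by distances within a block -/

/-- In both cases of the definition, `wordDist a s b` is `s` plus half the sum of the weights of `a`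
and `b`. So the point in the middle contributes its full weight; in `wordDist_add_flip`, the
contributions of `b` and its inverse cancel. -/
theorem wordDist_add (a b c : PointColor) (s t : ℤ) :
    wordDist a (s + b.weight + t) c = wordDist a s b + wordDist b t c := by
  cases a <;> cases b <;> cases c <;> simp [wordDist, PointColor.weight] <;> ring

theorem wordDist_add_flip (a b c : PointColor) (s t : ℤ) :
    wordDist a (s + t) c = wordDist a s b + wordDist b.flip t c := by
  cases a <;> cases b <;> cases c <;> simp [wordDist, PointColor.weight] <;> ring

/-- The colors of two legs of a block can be inverted without changing their distance. -/
theorem exists_word_flip (hC : IsCategory C) {a b : PointColor × β} {x v : List (PointColor × β)}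
    (h : Mem C [] (a :: x ++ b :: v)) (hab : a.2 = b.2) :
    ∃ (γ : Type) (L : γ) (y z : List (PointColor × γ)),
      Mem C [] ((a.1.flip, L) :: y ++ (b.1.flip, L) :: z) ∧
      wordDist a.1.flip (wordSum y) b.1.flip = wordDist a.1 (wordSum x) b.1 := by
  -- In the cyclic word `w w̄`, the way from `ā` to `b̄` passes through `a x b v v̄`, where `v` and
  -- `v̄` cancel in the color sum.
  have h₁ := h.tensor hC (h.reflect hC)
  refine ⟨β ⊕ β, Sum.inr b.2, relabel Sum.inl (a :: x ++ b :: v) ++ relabel Sum.inr (reflect v),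
    relabel Sum.inr (reflect x), ?_, ?_⟩
  · have h₂ := Mem.rotate hC (u := relabel Sum.inl (a :: x ++ b :: v) ++
      relabel Sum.inr (reflect v ++ (b.1.flip, b.2) :: reflect x))
      (v := [(a.1.flip, Sum.inr a.2)]) (by simpa using h₁)
    simpa [hab] using h₂
  · obtain ⟨a, l⟩ := a
    obtain ⟨b, l'⟩ := b
    cases a <;> cases b <;> simp [wordDist, PointColor.weight]

/-- Distances of crossing blocks can be changed by the distance of two legs of a block. -/
theorem add_mem_paramX (hC : IsCategory C) {d e : ℤ} (hd : d ∈ paramX C)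
    (he : e ∈ paramL C ∪ paramK C) : d + e ∈ paramX C := by
  obtain ⟨β, a, b, x, v, h, hab, hX, rfl⟩ := exists_word_of_mem_paramX hC hd
  obtain ⟨γ, c, c', L, y, z, h', rfl⟩ : ∃ (γ : Type) (c c' : PointColor) (L : γ)
      (y z : List (PointColor × γ)), Mem C [] ((c, L) :: y ++ (c', L) :: z) ∧
      wordDist c (wordSum y) c' = e := by
    rcases he with he | he
    · obtain ⟨γ, c, L, y, z, h', he⟩ := exists_word_of_mem_paramL hC he
      exact ⟨γ, c, c, L, y, z, h', he⟩
    · obtain ⟨γ, c, L, y, z, h', he⟩ := exists_word_of_mem_paramK hC he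
      exact ⟨γ, c, c.flip, L, y, z, h', he⟩
  clear he
  -- Only letters of inverse colors can be glued; otherwise the colors of both legs are inverted
  -- first.
  wlog hc : c = b.1.flip generalizing γ c c' L y z
  · obtain ⟨γ', L', y', z', h'', he⟩ := exists_word_flip hC h' rfl
    rw [← he]
    refine this γ' _ _ L' y' z' h'' ?_
    change c.flip = b.1.flip
    revert hc
    cases c <;> cases b.1 <;> simp
  subst hc
  obtain ⟨δ, F, G, h₁, h₂, h₃⟩ := Mem.glue hC (u := a :: x) (t := [b]) (v := v) (by simpa using h)
    (t' := [(b.1.flip, L)]) (s := y ++ (c', L) :: z) (by simpa using h') (by simp)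
  have hFG : F b.2 = G L := by simpa using h₂
  -- Only the block of `b` meets the second word, so the labelling by "equals `b.2`", with `True` on
  -- the second word, is compatible. It keeps the block of `a` apart.
  obtain ⟨φ, hF, -⟩ := h₃ Prop (fun l => l = b.2) (fun _ => True) (by simp)
  have hne : F a.2 ≠ G L := fun e => by
    rw [← hFG] at e
    have := congrArg φ e
    simp [hF, hab] at this
  have := mem_paramX_of_mem (a := (a.1, F a.2)) (x := relabel F x ++ relabel G y)
    (b := (c', G L)) (v := relabel G z ++ relabel F v) (by simpa using h₁) hne ?_
  · simpa [← wordDist_add_flip] using this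
  -- The new leg `c'` takes the place of `b` in the sequence of labels, so the old alternation
  -- survives as a subsequence.
  · have hsub : (((a :: x ++ b :: v).map Prod.snd).map F).Sublist
        (((a.1, F a.2) :: (relabel F x ++ relabel G y) ++ (c', G L) ::
          (relabel G z ++ relabel F v)).map Prod.snd) := by
      simp only [List.map_append, List.map_cons, List.cons_append, map_snd_relabel,
        List.append_assoc, hFG]
      refine ((List.Sublist.refl _).append (.trans ?_ (List.sublist_append_right _ _))).cons_cons _
      exact (List.sublist_append_right _ _).cons_cons _
    rcases hX with hX | hX
    · exact Or.inl (by simpa [hFG] using (hX.map F).trans hsub)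
    · exact Or.inr (by simpa [hFG] using (hX.map F).trans hsub)

/-! ### Heights and the parity argument -/

/-- The color distances of the letters of a word from a preceding point of color `c`, the color
sum in front of the word being `s`, together with the labels. -/
noncomputable def heights (c : PointColor) : ℤ → List (PointColor × β) → List (ℤ × β)
  | _, [] => []
  | s, a :: w => (wordDist c s a.1, a.2) :: heights c (s + a.1.weight) w

theorem map_snd_heights (c : PointColor) (s : ℤ) (w : List (PointColor × β)) :
    (heights c s w).map Prod.snd = w.map Prod.snd := by
  induction w generalizing s <;> simp_all [heights]

theorem exists_of_mem_heights {c : PointColor} {s : ℤ} {w : List (PointColor × β)} {e : ℤ × β}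
    (he : e ∈ heights c s w) :
    ∃ w₁ a w₂, w = w₁ ++ a :: w₂ ∧ e = (wordDist c (s + wordSum w₁) a.1, a.2) := by
  induction w generalizing s with
  | nil => simp [heights] at he
  | cons b w ih =>
    rw [heights, List.mem_cons] at he
    rcases he with rfl | he
    · exact ⟨[], b, w, rfl, by simp⟩
    · obtain ⟨w₁, a, w₂, rfl, rfl⟩ := ih he
      exact ⟨b :: w₁, a, w₂, rfl, by simp [add_assoc]⟩

theorem pairwise_heights {R : ℤ × β → ℤ × β → Prop} {c : PointColor} {s : ℤ}
    {w : List (PointColor × β)}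
    (h : ∀ w₁ a w₂ b w₃, w = w₁ ++ a :: (w₂ ++ b :: w₃) →
      R (wordDist c (s + wordSum w₁) a.1, a.2)
        (wordDist c (s + wordSum w₁) a.1 + wordDist a.1 (wordSum w₂) b.1, b.2)) :
    (heights c s w).Pairwise R := by
  induction w generalizing s with
  | nil => exact List.Pairwise.nil
  | cons a w ih =>
    rw [heights, List.pairwise_cons]
    refine ⟨fun e he => ?_, ih fun w₁ b w₂ d w₃ hw => ?_⟩
    · obtain ⟨w₁, b, w₂, rfl, rfl⟩ := exists_of_mem_heights he
      rw [wordDist_add]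
      simpa using h [] a w₁ b w₂ rfl
    · simpa [add_assoc] using h (a :: w₁) b w₂ d w₃ (by rw [hw]; rfl)

theorem ediv_eq_ediv_pred {m : ℤ} (hm : 0 < m) (h : ℤ) :
    h / m = (h - 1) / m + if m ∣ h then 1 else 0 := by
  have e₁ := Int.mul_ediv_add_emod h m
  have l₁ := Int.emod_nonneg h hm.ne'
  have u₁ := Int.emod_lt_of_pos h hm
  split_ifs with hd
  · rw [Int.emod_eq_zero_of_dvd hd] at e₁
    have : (h - 1) / m = h / m - 1 := by
      rw [Int.ediv_eq_iff_of_pos hm]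
      constructor <;> nlinarith
    omega
  · have : h % m ≠ 0 := fun e => hd (Int.dvd_of_emod_eq_zero e)
    have : (h - 1) / m = h / m := by
      rw [Int.ediv_eq_iff_of_pos hm]
      have : 1 ≤ h % m := by omega
      constructor <;> nlinarith
    omega

open Classical in
/-- The parity of the number of letters of a word whose height is congruent to `d`. -/
theorem even_countP_heights {m : ℤ} (hm : 0 < m) (d : ℤ) (c : PointColor) (s : ℤ)
    (w : List (PointColor × β)) :
    Even (((heights c s w).countP fun e => m ∣ e.1 - d : ℕ) -
      ((s + wordSum w - d - if c = PointColor.white then 0 else 1) / m -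
        (s - d - if c = PointColor.white then 0 else 1) / m)) := by
  induction w generalizing s with
  | nil => simp [heights]
  | cons a w ih =>
    have h := ih (s + a.1.weight)
    -- Each letter is a unit step of the partial color sums. Its height is the upper end of the step
    -- if `c` is white and the lower end if `c` is black; the offset 0 or 1 compensates for this.
    -- The quotient by `m` then changes by ±1 exactly when the height is congruent to `d`.
    have step : Even ((if m ∣ wordDist c s a.1 - d then 1 else 0) -
      ((s + a.1.weight - d - if c = PointColor.white then 0 else 1) / m -
        (s - d - if c = PointColor.white then 0 else 1) / m)) := by
      obtain ⟨a, l⟩ := a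
      cases c <;> cases a <;> simp only [wordDist, PointColor.weight, if_true, reduceCtorEq,
        if_false]
      · have := ediv_eq_ediv_pred hm (s + 1 - d)
        rw [show s + 1 - d - 1 = s - d - 0 by ring] at this
        rw [show s + 1 - d - 0 = s + 1 - d by ring, this]
        exact ⟨0, by ring⟩
      · have := ediv_eq_ediv_pred hm (s - d)
        rw [show s - d - 1 = s + -1 - d - 0 by ring] at this
        rw [show s - d - 0 = s - d by ring, this]
        exact ⟨if m ∣ s - d then 1 else 0, by ring⟩
      · have := ediv_eq_ediv_pred hm (s - d)
        rw [show s + 1 - d - 1 = s - d by ring, this]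
        exact ⟨0, by ring⟩
      · have := ediv_eq_ediv_pred hm (s + -1 - d)
        rw [show s - d - 1 = s + -1 - d by ring, this]
        exact ⟨if m ∣ s + -1 - d then 1 else 0, by ring⟩
    rw [heights, List.countP_cons, wordSum_cons, ← add_assoc]
    have key : ∀ n i A B D : ℤ, Even (n - (A - B)) → Even (i - (B - D)) →
        Even (n + i - (A - D)) := fun n i A B D h₁ h₂ => by
      rw [show n + i - (A - D) = n - (A - B) + (i - (B - D)) by ring]
      exact h₁.add h₂
    have := key _ _ _ _ _ h step
    simpa only [Nat.cast_add, Nat.cast_ite, Nat.cast_one, Nat.cast_zero, decide_eq_true_eq]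
      using this

open Classical in
/-- If two legs of a block have distance `m` and all distances within blocks are multiples of `m`,
then crossing blocks realize the residue class of `d`. -/
theorem exists_mem_paramX (hC : IsCaseO C) {m : ℤ} (hm : 0 < m)
    (hdvd : ∀ e ∈ paramL C ∪ paramK C, m ∣ e) {c c' : PointColor} {L : β}
    {x v : List (PointColor × β)} (h : Mem C [] ((c, L) :: x ++ (c', L) :: v))
    (hdist : wordDist c (wordSum x) c' = m) (d : ℤ) (hd : c' = c.flip ∨ ¬ m ∣ d) :
    ∃ e ∈ paramX C, m ∣ e - d := by
  by_contra! hno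
  have hCC := hC.toIsCategory
  have hcount : ∀ l ∈ ((c, L) :: x ++ (c', L) :: v).map Prod.snd,
      List.count l (L :: (x.map Prod.snd ++ L :: v.map Prod.snd)) = 2 := fun l hl => by
    simpa using h.count_eq_two hC hl
  have hL := hcount L (by simp)
  simp only [List.count_cons_self, List.count_append] at hL
  have hLx : L ∉ x.map Prod.snd := List.count_eq_zero.1 (by omega)
  have hLv : L ∉ v.map Prod.snd := List.count_eq_zero.1 (by omega)
  -- If a letter `y` of height ≡ `d` had its partner behind the second leg, the labels `L, y, L, y`
  -- would alternate, and the height of `y` would be a crossing distance in the excluded class.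
  have hout : ∀ e ∈ heights c 0 x, m ∣ e.1 - d → e.2 ∉ v.map Prod.snd := by
    intro e he hed hv
    obtain ⟨x₁, y, x₂, rfl, rfl⟩ := exists_of_mem_heights he
    have hne : L ≠ y.2 := by
      rintro rfl
      exact hLx (by simp)
    refine hno _ (mem_paramX_of_mem (a := (c, L)) (x := x₁) (b := y) (v := x₂ ++ (c', L) :: v)
      (by simpa using h) hne (Or.inl ?_)) (by simpa using hed)
    simp only [List.map_append, List.map_cons, List.cons_append]
    refine List.Sublist.cons_cons _ (.trans ?_ (List.sublist_append_right _ _))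
    refine List.Sublist.cons_cons _ (.trans ?_ (List.sublist_append_right _ _))
    exact (List.singleton_sublist.2 hv).cons_cons _
  have hpair : (heights c 0 x).Pairwise fun e e' => e.2 = e'.2 → m ∣ e.1 - e'.1 := by
    refine pairwise_heights ?_
    rintro x₁ a x₂ b x₃ rfl hab
    simp only at hab
    have ha := hcount a.2 (by simp)
    -- A label occurs only twice, so the two legs are subsequent and their distance lies in L ∪ K.
    have hax : a.2 ∉ x₂.map Prod.snd := by
      refine List.count_eq_zero.1 ?_
      simp only [List.map_append, List.map_cons, List.count_append, ← hab, List.count_cons] at ha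
      simp only [BEq.rfl, if_true] at ha
      omega
    have := hdvd _ (mem_params_of_mem (a := a) (x := x₂) (b := b)
      (v := x₃ ++ (c', L) :: v ++ (c, L) :: x₁)
      (by
        have := Mem.rotate hCC (u := (c, L) :: x₁)
          (v := a :: x₂ ++ b :: (x₃ ++ (c', L) :: v)) (by simpa using h)
        simpa using this) hab hax)
    simpa using this
  have hall : ∀ e ∈ heights c 0 x, ∀ e' ∈ heights c 0 x, e.2 = e'.2 → m ∣ e.1 - e'.1 := by
    intro e he e' he'
    refine hpair.forall_of_forall_of_flip (fun e _ _ => by simp) ?_ he he'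
    exact hpair.imp fun h h' => (dvd_sub_comm).1 (h h'.symm)
  have heven : Even ((heights c 0 x).countP fun e => m ∣ e.1 - d) := by
    rw [List.countP_eq_length_filter]
    set M := (heights c 0 x).filter fun e => m ∣ e.1 - d with hM
    rw [← List.length_map (f := Prod.snd) (as := M), ← List.sum_toFinset_count_eq_length]
    refine Finset.even_sum _ fun l hl => ?_
    obtain ⟨e, he, rfl⟩ := List.mem_map.1 (List.mem_toFinset.1 hl)
    rw [hM, List.mem_filter, decide_eq_true_eq] at he
    have hex : e.2 ∈ x.map Prod.snd := by
      rw [← map_snd_heights c 0 x]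
      exact List.mem_map_of_mem he.1
    -- Legs in `x` of one block have congruent heights, so the filter keeps either all or none of
    -- them.
    have h₁ : (M.map Prod.snd).count e.2 = (x.map Prod.snd).count e.2 := by
      rw [← map_snd_heights c 0 x, List.count_eq_countP, List.count_eq_countP, List.countP_map, List.countP_map, hM,
        List.countP_filter]
      refine List.countP_congr fun e' he' => ?_
      simp only [Function.comp_apply, Bool.and_eq_true, beq_iff_eq, decide_eq_true_eq,
        and_iff_left_iff_imp]
      intro hee
      have := dvd_add (hall e' he' e he.1 hee) he.2
      simpa using this
    -- The label differs from `L` and does not occur in `v`, so both of its occurrences lie in `x`.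
    have h₂ := hcount e.2 (by
      simp only [List.map_append, List.map_cons, List.mem_append, List.mem_cons]
      exact Or.inl (Or.inr hex))
    have h₃ : L ≠ e.2 := fun e' => hLx (e' ▸ hex)
    simp only [List.count_cons, List.count_append, List.count_eq_zero.2 (hout e he.1 he.2)] at h₂
    simp only [beq_iff_eq, h₃, if_false] at h₂
    rw [h₁]
    exact ⟨1, by omega⟩
  have hpar := even_countP_heights hm d c 0 x
  rw [Int.even_sub] at hpar
  have hpar := hpar.1 (by exact_mod_cast heven)
  have e₁ : ∀ z : ℤ, (m + z) / m = z / m + 1 := fun z => by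
    rw [add_comm m z, Int.add_ediv_of_dvd_right dvd_rfl, Int.ediv_self hm.ne']
  have e₂ : ¬ m ∣ d → (-d) / m = (-d - 1) / m := fun hd => by
    rw [ediv_eq_ediv_pred hm (-d), if_neg (by rwa [dvd_neg]), add_zero]
  -- For equal colors the distance `m` includes the weight of the second leg, which is not part of
  -- `x`.
  have hs : wordSum x = if c' = c then m - c.weight else m := by
    rw [wordDist] at hdist
    split_ifs at hdist ⊢ with h₁ h₂ h₂
    · subst h₁; omega
    · exact absurd h₁.symm h₂
    · exact absurd h₂.symm h₁
    · exact hdist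
  rw [hs] at hpar
  -- In all four cases the difference of the quotients is 1, against the evenness of `hpar`. For
  -- equal colors the start and end values differ by `m` only up to one unit, and `e₂` bridges this
  -- if `m` does not divide `d`.
  cases c <;> cases c' <;> simp [PointColor.weight] at hpar hd
  · have h₁ := e₁ (-d - 1)
    rw [← e₂ hd] at h₁
    rw [show m - 1 - d = m + (-d - 1) by ring, h₁] at hpar
    simp at hpar
  · rw [show m - d = m + -d by ring, e₁] at hpar
    simp at hpar
  · rw [show m - d - 1 = m + (-d - 1) by ring, e₁] at hpar
    simp at hpar
  · rw [show m + 1 - d - 1 = m + -d by ring, e₁, e₂ hd] at hpar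
    simp at hpar

end ColoredPartition

/-! ### The proposition -/

theorem proposition7p4 (C : Set AnyColoredPartition) (hC : ColoredPartition.IsCaseO C)
    (m : ℕ) (hm : 1 ≤ m) :
    ((ColoredPartition.paramL C = {z : ℤ | ∃ n : ℤ, z = (m : ℤ) + 2 * (m : ℤ) * n} ∧
        ColoredPartition.paramK C = {z : ℤ | ∃ n : ℤ, z = 2 * (m : ℤ) * n}) →
      (ColoredPartition.paramX C = Set.univ ∨
        ColoredPartition.paramX C = Set.univ \ {z : ℤ | ∃ n : ℤ, z = (m : ℤ) * n})) ∧
    (((ColoredPartition.paramL C = {z : ℤ | ∃ n : ℤ, z = (m : ℤ) * n} ∧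
          ColoredPartition.paramK C = {z : ℤ | ∃ n : ℤ, z = (m : ℤ) * n}) ∨
        (ColoredPartition.paramL C = ∅ ∧
          ColoredPartition.paramK C = {z : ℤ | ∃ n : ℤ, z = (m : ℤ) * n})) →
      ColoredPartition.paramX C = Set.univ) := by
  have hCC := hC.toIsCategory
  have hm' : (0 : ℤ) < m := by exact_mod_cast hm
  -- Once L ∪ K contains all multiples of `m`, a single element of X yields its whole residue class.
  have shift : (∀ n : ℤ, (m : ℤ) * n ∈ ColoredPartition.paramL C ∪ ColoredPartition.paramK C) →
      ∀ d, (∃ e ∈ ColoredPartition.paramX C, (m : ℤ) ∣ e - d) → d ∈ ColoredPartition.paramX C := by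
    rintro h d ⟨e, he, n, hn⟩
    have := ColoredPartition.add_mem_paramX hCC he (h (-n))
    rwa [show e + (m : ℤ) * -n = d by linarith] at this
  constructor
  · rintro ⟨hL, hK⟩
    have hdvd : ∀ e ∈ ColoredPartition.paramL C ∪ ColoredPartition.paramK C, (m : ℤ) ∣ e := by
      rw [hL, hK]
      rintro e (⟨n, rfl⟩ | ⟨n, rfl⟩)
      · exact ⟨1 + 2 * n, by ring⟩
      · exact ⟨2 * n, by ring⟩
    have hmem : ∀ n : ℤ, (m : ℤ) * n ∈ ColoredPartition.paramL C ∪ ColoredPartition.paramK C := by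
      intro n
      rw [hL, hK]
      obtain ⟨k, rfl | rfl⟩ := Int.even_or_odd' n
      · exact Or.inr ⟨k, by ring⟩
      · exact Or.inl ⟨k, by ring⟩
    have hmL : (m : ℤ) ∈ ColoredPartition.paramL C := by
      rw [hL]
      exact ⟨0, by ring⟩
    obtain ⟨β, c, L, x, v, h, hdist⟩ := ColoredPartition.exists_word_of_mem_paramL hCC hmL
    have hX : ∀ d : ℤ, ¬ (m : ℤ) ∣ d → d ∈ ColoredPartition.paramX C := fun d hd =>
      shift hmem d (ColoredPartition.exists_mem_paramX hC hm' hdvd h hdist d (Or.inr hd))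
    -- The classes other than that of 0 are settled; the class of 0 lies in X entirely or not at
    -- all.
    by_cases hz : ∃ e ∈ ColoredPartition.paramX C, (m : ℤ) ∣ e
    · left
      refine Set.eq_univ_of_forall fun d => ?_
      by_cases hd : (m : ℤ) ∣ d
      · obtain ⟨e, he, hme⟩ := hz
        exact shift hmem d ⟨e, he, dvd_sub hme hd⟩
      · exact hX d hd
    · right
      ext d
      constructor
      · exact fun hd => ⟨trivial, fun h => hz ⟨d, hd, h⟩⟩
      · exact fun hd => hX d hd.2
  · intro h
    have hK : ColoredPartition.paramK C = {z : ℤ | ∃ n : ℤ, z = (m : ℤ) * n} := by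
      rcases h with h | h <;> exact h.2
    have hdvd : ∀ e ∈ ColoredPartition.paramL C ∪ ColoredPartition.paramK C, (m : ℤ) ∣ e := by
      rintro e (he | he)
      · rcases h with h | h
        · rw [h.1] at he
          exact he
        · rw [h.1] at he
          exact he.elim
      · rw [hK] at he
        exact he
    have hmem : ∀ n : ℤ, (m : ℤ) * n ∈ ColoredPartition.paramL C ∪ ColoredPartition.paramK C :=
      fun n => Or.inr (by rw [hK]; exact ⟨n, rfl⟩)
    have hmK : (m : ℤ) ∈ ColoredPartition.paramK C := by
      rw [hK]
      exact ⟨1, by ring⟩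
    obtain ⟨β, c, L, x, v, h, hdist⟩ := ColoredPartition.exists_word_of_mem_paramK hCC hmK
    exact Set.eq_univ_of_forall fun d => shift hmem d
      (ColoredPartition.exists_mem_paramX hC hm' hdvd h hdist d (Or.inl rfl))
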